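/- Let $0<\varepsilon<2$. Let $H_0$ be the operator on the complex Hilbert space $L^2(-\pi,\pi)$ whose domain is $\mathcal{C}^2_{\mathrm{per}}([-\pi,\pi])$ (the restrictions to $[-\pi,\pi]$ of $2\pi$-periodic $C^2$ functions $f:\mathbb{R}\to\mathbb{C}$), defined by $$(H_0f)(\theta)=\varepsilon\frac{\partial}{\partial\theta}\left(\sin(\theta)\frac{\partial f}{\partial\theta}\right)+\frac{\partial f}{\partial\theta}.$$ Then $H_0$ is closable. Let $H$ be its closure. The operator $-iH$ has infinitely many eigenvalues. All of its eigenvalues are real, and the set of eigenvalues can be enumerated, in strictly increasing order, as $\{\lambda_n\}_{n\in\mathbb{Z}}$ (so that $\lambda_m<\lambda_n$ whenever $m<n$), with $\lambda_0=0$, $\lambda_{-n}=-\lambda_n$ for all $n\in\mathbb{Z}$, and $\lambda_n\to\infty$ as $n\to\infty$. -/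

import Mathlib

open MeasureTheory

namespace FilmFlow

noncomputable section

/-- The Hilbert space of (classes of) square-integrable complex functions on `(-π, π)`,
with respect to Lebesgue measure. -/
abbrev L2 : Type := Lp ℂ 2 ((volume : Measure ℝ).restrict (Set.Ioo (-Real.pi) Real.pi))

theorem memLp_of_continuous {f : ℝ → ℂ} (hf : Continuous f) :
    MemLp f 2 ((volume : Measure ℝ).restrict (Set.Ioo (-Real.pi) Real.pi)) := by
  obtain ⟨C, hC⟩ := (isCompact_Icc (a := -Real.pi) (b := Real.pi)).exists_bound_of_continuousOn
    hf.continuousOn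
  refine MemLp.of_bound hf.aestronglyMeasurable C ?_
  filter_upwards [ae_restrict_mem measurableSet_Ioo] with x hx
  exact hC x (Set.Ioo_subset_Icc_self hx)

/-- The space of twice continuously differentiable periodic functions on `[-π, π]`,
each given as its `2π`-periodic extension to the real line. -/
def C2per : Submodule ℂ (ℝ → ℂ) where
  carrier := {f | ContDiff ℝ 2 f ∧ Function.Periodic f (2 * Real.pi)}
  zero_mem' := ⟨contDiff_const, fun _ => rfl⟩
  add_mem' hf hg := ⟨hf.1.add hg.1, hf.2.add hg.2⟩
  smul_mem' c _ hf := ⟨contDiff_const.smul hf.1, hf.2.smul c⟩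

/-- The differential expression `f ↦ ε (sin θ · f')' + f'`. -/
def filmExpr (ε : ℝ) (f : ℝ → ℂ) (θ : ℝ) : ℂ :=
  (ε : ℂ) * deriv (fun t : ℝ => (Real.sin t : ℂ) * deriv f t) θ + deriv f θ

theorem contDiff_sin_mul_deriv {f : ℝ → ℂ} (hf : ContDiff ℝ 2 f) :
    ContDiff ℝ 1 (fun t : ℝ => (Real.sin t : ℂ) * deriv f t) := by
  have h1 : ContDiff ℝ 1 (deriv f) := by
    have h2 : ContDiff ℝ (1 + 1) f := by
      rw [one_add_one_eq_two]
      exact hf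
    exact (contDiff_succ_iff_deriv.1 h2).2.2
  have h2 : ContDiff ℝ 1 (fun t : ℝ => (Real.sin t : ℂ)) :=
    Complex.ofRealCLM.contDiff.comp Real.contDiff_sin
  exact h2.mul h1

theorem continuous_filmExpr (ε : ℝ) {f : ℝ → ℂ} (hf : ContDiff ℝ 2 f) :
    Continuous (filmExpr ε f) :=
  (continuous_const.mul ((contDiff_sin_mul_deriv hf).continuous_deriv le_rfl)).add
    (hf.continuous_deriv (by norm_num))

theorem filmExpr_add (ε : ℝ) {f g : ℝ → ℂ} (hf : ContDiff ℝ 2 f) (hg : ContDiff ℝ 2 g) :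
    filmExpr ε (f + g) = filmExpr ε f + filmExpr ε g := by
  have hf' : Differentiable ℝ f := hf.differentiable (by norm_num)
  have hg' : Differentiable ℝ g := hg.differentiable (by norm_num)
  have hd : deriv (f + g) = deriv f + deriv g := funext fun t => deriv_add (hf' t) (hg' t)
  have hm : (fun t : ℝ => (Real.sin t : ℂ) * deriv (f + g) t)
      = (fun t : ℝ => (Real.sin t : ℂ) * deriv f t)
        + (fun t : ℝ => (Real.sin t : ℂ) * deriv g t) := by
    funext t
    simp [hd, mul_add]
  funext θ
  have hs := deriv_add ((contDiff_sin_mul_deriv hf).differentiable (by norm_num) θ)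
    ((contDiff_sin_mul_deriv hg).differentiable (by norm_num) θ)
  simp only [filmExpr, Pi.add_apply]
  rw [hm, hs, hd, Pi.add_apply]
  ring

theorem filmExpr_smul (ε : ℝ) (c : ℂ) {f : ℝ → ℂ} (hf : ContDiff ℝ 2 f) :
    filmExpr ε (c • f) = c • filmExpr ε f := by
  have hf' : Differentiable ℝ f := hf.differentiable (by norm_num)
  have hd : deriv (c • f) = c • deriv f := funext fun t => deriv_const_smul c (hf' t)
  have hm : (fun t : ℝ => (Real.sin t : ℂ) * deriv (c • f) t)
      = c • (fun t : ℝ => (Real.sin t : ℂ) * deriv f t) := by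
    funext t
    simp only [hd, Pi.smul_apply, smul_eq_mul]
    ring
  funext θ
  have hs := deriv_const_smul c ((contDiff_sin_mul_deriv hf).differentiable (by norm_num) θ)
  simp only [filmExpr, Pi.smul_apply]
  rw [hm, hs, hd]
  simp only [Pi.smul_apply, smul_eq_mul]
  ring

/-- The inclusion of the periodic twice continuously differentiable functions in
`L²(-π, π)`. -/
def toL2 : C2per →ₗ[ℂ] L2 where
  toFun f := (memLp_of_continuous f.2.1.continuous).toLp f.1
  map_add' _ _ := rfl
  map_smul' _ _ := rfl

/-- The map `f ↦ ε (sin θ · f')' + f'` from the periodic twice continuously differentiable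
functions to `L²(-π, π)`. -/
def filmMap (ε : ℝ) : C2per →ₗ[ℂ] L2 where
  toFun f := (memLp_of_continuous (continuous_filmExpr ε f.2.1)).toLp (filmExpr ε f.1)
  map_add' f g := by
    rw [← MemLp.toLp_add]
    congr 1
    exact filmExpr_add ε f.2.1 g.2.1
  map_smul' c f := by
    rw [RingHom.id_apply, ← MemLp.toLp_const_smul]
    congr 1
    exact filmExpr_smul ε c f.2.1

theorem toL2_injective : Function.Injective toL2 := by
  intro f g h
  have hae : f.1 =ᵐ[(volume : Measure ℝ).restrict (Set.Ioo (-Real.pi) Real.pi)] g.1 :=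
    (MemLp.toLp_eq_toLp_iff (memLp_of_continuous f.2.1.continuous)
      (memLp_of_continuous g.2.1.continuous)).1 h
  have hfc : Continuous f.1 := f.2.1.continuous
  have hgc : Continuous g.1 := g.2.1.continuous
  have hIoo : Set.EqOn f.1 g.1 (Set.Ioo (-Real.pi) Real.pi) :=
    Measure.eqOn_open_of_ae_eq hae isOpen_Ioo hfc.continuousOn hgc.continuousOn
  have hne : -Real.pi ≠ Real.pi := by linarith [Real.pi_pos]
  have hIcc : Set.EqOn f.1 g.1 (Set.Icc (-Real.pi) Real.pi) := by
    rw [← closure_Ioo hne]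
    exact hIoo.closure hfc hgc
  apply Subtype.ext
  funext x
  have hp : Function.Periodic (f.1 - g.1) (2 * Real.pi) := f.2.2.sub g.2.2
  obtain ⟨y, hy, hxy⟩ := hp.exists_mem_Ico (by positivity) x (-Real.pi)
  have hy' : y ∈ Set.Icc (-Real.pi) Real.pi := ⟨hy.1, by linarith [hy.2]⟩
  have h0 : f.1 x - g.1 x = f.1 y - g.1 y := hxy
  rw [hIcc hy', sub_self] at h0
  exact sub_eq_zero.1 h0

/-- The unbounded operator `H₀` on `L²(-π, π)`, with domain the periodic twice continuously
differentiable functions, given by `H₀ f = ε (sin θ · f')' + f'`. -/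
def H₀ (ε : ℝ) : L2 →ₗ.[ℂ] L2 where
  domain := LinearMap.range toL2
  toFun := (filmMap ε).comp (LinearEquiv.ofInjective toL2 toL2_injective).symm.toLinearMap

/-- On a periodic twice continuously differentiable `f`, the operator `H₀` is the differential
expression. -/
theorem H₀_apply (ε : ℝ) (f : C2per) :
    H₀ ε ⟨toL2 f, LinearMap.mem_range_self toL2 f⟩ = filmMap ε f :=
  congrArg (filmMap ε) ((LinearEquiv.ofInjective toL2 toL2_injective).symm_apply_apply f)

/-- The film-flow operator `H`: the closure of `H₀`. -/
def H (ε : ℝ) : L2 →ₗ.[ℂ] L2 := (H₀ ε).closure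

/-- `z` is an eigenvalue of the unbounded operator `T`: there is a nonzero `f` in the domain
of `T` with `T f = z f`. -/
def IsEigenvalue (T : L2 →ₗ.[ℂ] L2) (z : ℂ) : Prop :=
  ∃ f : T.domain, (f : L2) ≠ 0 ∧ T f = z • (f : L2)

end

end FilmFlow

namespace FilmFlow

/-! In Fourier coordinates `H` becomes the recurrence `filmCoeff`. The factor `n` in it kills every
coupling through the mode `0`, so constants are eigenfunctions for `0`, the positive and negative
modes decouple, and the reflection `n ↦ -n` exchanges the eigenvalues `z` and `-z`. Only the
positive modes have to be studied.

Put `α = 1 / ε` and `lam = z`. On the positive modes the eigenvalue equation has one formal solution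
`vSeq`, up to a scalar. Its generating function `g(z) = ∑ v n z ^ n` solves on `(0, 1)` the
Sturm–Liouville equation `(p g')' = -2 α lam r g / z`, with `r = ((1 - z) / (1 + z)) ^ α` and `p =
(1 - z ^ 2) r`. At `z = 1` the exponents are `0` and `-α`. The solution `f` with exponent `0` is the
power series of `cSeq` in `x = (1 - z) / (1 + z)`, and `secular` is its value at `x = 1`, that is at
`z = 0`. The Wronskian `p (f g' - f' g)` is constant and equals `secular` (`wronskian_eq_secular`).

If `v` is square summable, then `p g' = O((1 - z) ^ (α - 1/2))`; as `ε < 2` gives `α > 1/2`, the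
Wronskian tends to `0` at `z = 1` and `secular` vanishes (`secular_eq_zero_of_summable`).
Conversely, at a zero of `secular` the function `g` is a multiple of `f` near `1`, so `g` and `g'`
stay bounded there. A Lagrange identity makes `lam` real, and an energy argument on the recurrence
makes `n v n` square summable (`summable_uSeq_of_secular_eq_zero`). Cutting off the Fourier series
then puts the eigenfunction in the domain of the closure (`mem_closure_of_summable`). So the
eigenvalues are `0` and `±` the zeros of `secular`.

These zeros are positive, since `secular` is at least `1` on the nonpositive axis. They are locally
finite, since `secular` is entire and nonzero. They are infinitely many because `secular` has order
below `1` and outgrows every polynomial along the negative axis, which an entire function with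
finitely many zeros cannot do (`infinite_zeros_of_growth`). -/

open Filter Topology Set

/-! ### Entire functions of order below one -/

/-- A nonvanishing entire function is the exponential of an entire function. -/
theorem exists_entire_log {G : ℂ → ℂ} (hG : Differentiable ℂ G) (h0 : ∀ z, G z ≠ 0) :
    ∃ h : ℂ → ℂ, Differentiable ℂ h ∧ ∀ z, G z = Complex.exp (h z) := by
  -- The logarithm is a primitive of `G' / G`, normalised at `0`; then `G * exp (-h)` has zero
  -- derivative.
  have hd : Differentiable ℂ (fun z => deriv G z / G z) :=
    (hG.contDiff (n := 2)).differentiable_deriv_two.div hG h0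
  obtain ⟨h, hh0, hh⟩ := (Differentiable.isExactOn_univ hd).with_val_at 0 (Complex.log (G 0))
  have hh' : ∀ z, HasDerivAt h (deriv G z / G z) z := fun z => hh z (mem_univ z)
  refine ⟨h, fun z => (hh' z).differentiableAt, fun z => ?_⟩
  have hk : ∀ z, HasDerivAt (fun z => G z * Complex.exp (-h z)) 0 z := by
    intro z
    have := (hG z).hasDerivAt.mul ((hh' z).neg.cexp)
    convert! this using 1
    field_simp [h0 z]
    ring
  have hc := is_const_of_deriv_eq_zero (fun z => (hk z).differentiableAt)
    (fun z => (hk z).deriv) z 0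
  simp only [hh0, Complex.exp_neg, Complex.exp_log (h0 0), mul_inv_cancel₀ (h0 0)] at hc
  field_simp at hc
  exact hc

/-- The zero of an entire function at a point can be divided out. -/
theorem exists_entire_div {F : ℂ → ℂ} (hF : Differentiable ℂ F) (hne : ∃ z, F z ≠ 0) (z₀ : ℂ) :
    ∃ (m : ℕ) (G : ℂ → ℂ), Differentiable ℂ G ∧ G z₀ ≠ 0 ∧ ∀ z, F z = (z - z₀) ^ m * G z := by
  have han : AnalyticOnNhd ℂ F univ := fun z _ => hF.analyticAt z
  have hnt : ¬ ∀ᶠ z in 𝓝 z₀, F z = 0 := by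
    intro h
    obtain ⟨z, hz⟩ := hne
    exact hz (han.eqOn_zero_of_preconnected_of_eventuallyEq_zero isPreconnected_univ
      (mem_univ z₀) h (mem_univ z))
  obtain ⟨m, g, hg, hg0, hgF⟩ :=
    (hF.analyticAt z₀).exists_eventuallyEq_pow_smul_nonzero_iff.2 hnt
  classical
  refine ⟨m, Function.update (fun z => F z / (z - z₀) ^ m) z₀ (g z₀), fun z => ?_, by simpa, ?_⟩
  · by_cases hz : z = z₀
    · subst hz
      refine hg.differentiableAt.congr_of_eventuallyEq ?_
      filter_upwards [hgF] with w hw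
      by_cases hwz : w = z
      · subst hwz; simp
      · have : w - z ≠ 0 := sub_ne_zero.2 hwz
        simp only [Function.update_of_ne hwz, hw, smul_eq_mul]
        field_simp
    · have h1 : DifferentiableAt ℂ (fun z => F z / (z - z₀) ^ m) z := by
        refine (hF z).div (by fun_prop) (pow_ne_zero _ (sub_ne_zero.2 hz))
      refine h1.congr_of_eventuallyEq ?_
      filter_upwards [isOpen_ne.mem_nhds hz] with w hw
      rw [Function.update_of_ne hw]
  · intro z
    by_cases hz : z = z₀
    · subst hz
      have := hgF.self_of_nhds
      simpa using this
    · have : z - z₀ ≠ 0 := sub_ne_zero.2 hz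
      rw [Function.update_of_ne hz]
      field_simp

/-- An entire function with finitely many zeros is a polynomially bounded factor times a
nonvanishing entire function. -/
theorem exists_factor_of_finite_zeros (S : Finset ℂ) :
    ∀ F : ℂ → ℂ, Differentiable ℂ F → (∃ z, F z ≠ 0) → (∀ z, F z = 0 → z ∈ S) →
    ∃ (P G : ℂ → ℂ) (d : ℕ) (R : ℝ), Differentiable ℂ G ∧ (∀ z, G z ≠ 0) ∧
      (∀ z, F z = P z * G z) ∧ ∀ z, R ≤ ‖z‖ → 1 ≤ ‖P z‖ ∧ ‖P z‖ ≤ (2 * ‖z‖) ^ d := by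
  induction S using Finset.induction_on with
  | empty =>
    intro F hF _ hz
    exact ⟨1, F, 0, 0, hF, fun z h => by simpa using hz z h, by simp, by simp⟩
  | insert a S ha ih =>
    intro F hF hne hz
    obtain ⟨m, G, hG, hGa, hFG⟩ := exists_entire_div hF hne a
    obtain ⟨P, K, d, R, hK, hK0, hGK, hP⟩ := ih G hG ⟨a, hGa⟩ (by
      intro z h
      have h1 := hz z (by rw [hFG, h, mul_zero])
      rcases Finset.mem_insert.1 h1 with rfl | h2
      · exact absurd h hGa
      · exact h2)
    refine ⟨fun z => (z - a) ^ m * P z, K, m + d, max R (‖a‖ + 1), hK, hK0, ?_, ?_⟩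
    · intro z; rw [hFG, hGK]; ring
    · intro z hz
      have h1 := hP z ((le_max_left _ _).trans hz)
      have h2 : ‖a‖ + 1 ≤ ‖z‖ := (le_max_right _ _).trans hz
      have h3 : 1 ≤ ‖z - a‖ := by linarith [norm_sub_norm_le z a]
      have h4 : ‖z - a‖ ≤ 2 * ‖z‖ := by linarith [norm_sub_le z a]
      rw [norm_mul, norm_pow, pow_add]
      refine ⟨one_le_mul_of_one_le_of_one_le (one_le_pow₀ h3) h1.1, ?_⟩
      gcongr
      exact h1.2

/-- An entire function of order less than one that grows faster than every polynomial along the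
negative axis has infinitely many zeros. -/
theorem infinite_zeros_of_growth {F : ℂ → ℂ} (hF : Differentiable ℂ F) {A ρ : ℝ} (hA : 0 < A)
    (hρ0 : 0 < ρ) (hρ : ρ < 1) (hup : ∀ z, ‖F z‖ ≤ Real.exp (A * (1 + ‖z‖ ^ ρ)))
    (hlow : ∀ d : ℕ, ∃ c : ℝ, 0 < c ∧ ∀ s : ℝ, 0 ≤ s → c * s ^ d ≤ ‖F (-s)‖) :
    {z | F z = 0}.Infinite := by
  intro hfin
  have hne : ∃ z, F z ≠ 0 := by
    obtain ⟨c, hc, h⟩ := hlow 0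
    refine ⟨-((1 : ℝ) : ℂ), fun h0 => ?_⟩
    have := h 1 zero_le_one
    rw [h0] at this
    simp at this
    linarith
  obtain ⟨P, G, d, R, hG, hG0, hFG, hP⟩ :=
    exists_factor_of_finite_zeros hfin.toFinset F hF hne (fun z hz => by simpa using hz)
  obtain ⟨h, hh, hGh⟩ := exists_entire_log hG hG0
  -- On the circle of radius `r` the factor `P` has modulus at least `1`, so `G` inherits the bound
  -- of `F`; the maximum principle carries it inside.
  have hGb : ∀ r : ℝ, max R 1 ≤ r → ∀ z ∈ Metric.ball (0 : ℂ) r,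
      ‖G z‖ ≤ Real.exp (A * (1 + r ^ ρ)) := by
    intro r hr z hz
    have hr0 : r ≠ 0 := by linarith [le_max_right R 1]
    refine Complex.norm_le_of_forall_mem_frontier_norm_le Metric.isBounded_ball
      hG.diffContOnCl (fun w hw => ?_) (subset_closure hz)
    rw [frontier_ball _ hr0, mem_sphere_zero_iff_norm] at hw
    have h1 := (hP w (by rw [hw]; exact (le_max_left _ _).trans hr)).1
    have h2 := hup w
    rw [hFG, norm_mul, hw] at h2
    nlinarith [norm_nonneg (G w)]
  have hconst : ∀ z, h z = h 0 := by
    intro z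
    -- Borel–Carathéodory: the real part of `h` is `O(r ^ ρ)`, so the bound tends to `0` as `r → ∞`
    -- because `ρ < 1`.
    have key : ∀ᶠ r : ℝ in atTop,
        ‖h z - h 0‖ ≤ 2 * (A * (1 + r ^ ρ) + ‖h 0‖) * ‖z‖ / (r - ‖z‖) := by
      filter_upwards [eventually_ge_atTop (max R 1), eventually_gt_atTop ‖z‖] with r hr hrz
      have hr0 : 0 < r := (norm_nonneg z).trans_lt hrz
      refine Complex.borelCaratheodory_zero (f := fun z => h z - h 0) (by positivity)
        (hh.sub_const _).differentiableOn ?_ hr0 (by simpa using hrz) (sub_self _)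
      intro w hw
      have h1 := hGb r hr w hw
      rw [hGh, Complex.norm_exp, Real.exp_le_exp] at h1
      have h2 := neg_le_of_abs_le (Complex.abs_re_le_norm (h 0))
      simp only [mem_ofPred_eq, Complex.sub_re]
      linarith
    have hlim : Tendsto (fun r : ℝ => 2 * (A * (1 + r ^ ρ) + ‖h 0‖) * ‖z‖ / (r - ‖z‖))
        atTop (𝓝 0) := by
      have e1 : Tendsto (fun r : ℝ => r ^ (-(1 - ρ))) atTop (𝓝 0) :=
        tendsto_rpow_neg_atTop (by linarith)
      have e2 : Tendsto (fun r : ℝ => r⁻¹) atTop (𝓝 0) := tendsto_inv_atTop_zero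
      have e3 : Tendsto (fun r : ℝ => (2 * (A * (r⁻¹ + r ^ (-(1 - ρ))) + ‖h 0‖ * r⁻¹) * ‖z‖)
          / (1 - ‖z‖ * r⁻¹)) atTop
          (𝓝 ((2 * (A * (0 + 0) + ‖h 0‖ * 0) * ‖z‖) / (1 - ‖z‖ * 0))) := by
        refine Tendsto.div ?_ ?_ (by simp)
        · exact ((((e2.add e1).const_mul A).add (e2.const_mul _)).const_mul 2).mul_const _
        · exact (e2.const_mul _).const_sub 1
      simp only [add_zero, mul_zero, zero_mul, zero_div] at e3
      refine e3.congr' ?_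
      filter_upwards [eventually_gt_atTop (max ‖z‖ 0)] with r hr
      have hr0 : 0 < r := (le_max_right _ _).trans_lt hr
      have hrz : 0 < r - ‖z‖ := sub_pos.2 ((le_max_left _ _).trans_lt hr)
      have e4 : r ^ (-(1 - ρ)) = r ^ ρ / r := by
        rw [neg_sub, Real.rpow_sub hr0, Real.rpow_one]
      rw [e4]
      have : 1 - ‖z‖ * r⁻¹ = (r - ‖z‖) / r := by field_simp
      rw [this]
      field_simp
    have := ge_of_tendsto hlim key
    exact sub_eq_zero.1 (norm_le_zero_iff.1 this)
  -- With `h` constant, `F` grows at most like the power `d`; the lower bound with power `d + 1`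
  -- contradicts this.
  obtain ⟨c, hc, hcs⟩ := hlow (d + 1)
  have hb : ∀ᶠ s : ℝ in atTop, s ≤ 2 ^ d * ‖G 0‖ / c := by
    filter_upwards [eventually_ge_atTop R, eventually_gt_atTop 0] with s hsR hs0
    have h1 := hcs s hs0.le
    have hs : ‖(-(s : ℂ))‖ = s := by simp [abs_of_pos hs0]
    have h2 := (hP (-s) (by rw [hs]; exact hsR)).2
    rw [hs] at h2
    rw [hFG, norm_mul, hGh, hconst, ← hGh] at h1
    have h3 : c * s ^ (d + 1) ≤ (2 * s) ^ d * ‖G 0‖ :=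
      h1.trans (by gcongr)
    rw [le_div_iff₀ hc]
    rw [mul_pow, pow_succ] at h3
    have hsd : 0 < s ^ d := by positivity
    have : s ^ d * (s * c) ≤ s ^ d * (2 ^ d * ‖G 0‖) := by linarith
    exact le_of_mul_le_mul_left this hsd
  obtain ⟨s, hs1, hs2⟩ := (hb.and (eventually_gt_atTop (2 ^ d * ‖G 0‖ / c))).exists
  linarith

/-! ### Power series with polynomially bounded coefficients -/

/-- The sequence `a` is bounded by a polynomial. -/
def PolyBdd (a : ℕ → ℂ) : Prop := ∃ (C : ℝ) (m : ℕ), ∀ k, ‖a k‖ ≤ C * ((k : ℝ) + 1) ^ m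

/-- The sum of the power series with coefficients `a`. -/
noncomputable def powSum (a : ℕ → ℂ) (z : ℂ) : ℂ := ∑' k, a k * z ^ k

theorem PolyBdd.of_le {a b : ℕ → ℂ} (hb : PolyBdd b) {C : ℝ} (h : ∀ k, ‖a k‖ ≤ C * ‖b k‖) :
    PolyBdd a := by
  obtain ⟨D, m, hD⟩ := hb
  refine ⟨|C| * D, m, fun k => (h k).trans ?_⟩
  rw [mul_assoc]
  exact mul_le_mul (le_abs_self C) (hD k) (norm_nonneg _) (abs_nonneg _)

theorem PolyBdd.shift {a : ℕ → ℂ} (ha : PolyBdd a) : PolyBdd (fun k => a (k + 1)) := by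
  obtain ⟨C, m, hC⟩ := ha
  have hC0 : 0 ≤ C := by simpa using (norm_nonneg _).trans (hC 0)
  refine ⟨C * 2 ^ m, m, fun k => (hC (k + 1)).trans ?_⟩
  rw [mul_assoc, ← mul_pow]
  gcongr
  push_cast
  linarith [(Nat.cast_nonneg k : (0 : ℝ) ≤ k)]

theorem PolyBdd.pred {a : ℕ → ℂ} (ha : PolyBdd a) : PolyBdd (fun k => a (k - 1)) := by
  obtain ⟨C, m, hC⟩ := ha
  have hC0 : 0 ≤ C := by simpa using (norm_nonneg _).trans (hC 0)
  refine ⟨C, m, fun k => (hC (k - 1)).trans ?_⟩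
  gcongr
  exact Nat.sub_le k 1

theorem PolyBdd.deriv {a : ℕ → ℂ} (ha : PolyBdd a) :
    PolyBdd (fun k => ((k : ℂ) + 1) * a (k + 1)) := by
  obtain ⟨C, m, hC⟩ := ha.shift
  refine ⟨C, m + 1, fun k => ?_⟩
  have : ‖((k : ℂ) + 1)‖ = (k : ℝ) + 1 := by
    rw [← Nat.cast_succ, Complex.norm_natCast]; push_cast; rfl
  rw [norm_mul, this, pow_succ]
  have := hC k
  nlinarith [(Nat.cast_nonneg k : (0 : ℝ) ≤ k)]

theorem PolyBdd.add {a b : ℕ → ℂ} (ha : PolyBdd a) (hb : PolyBdd b) :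
    PolyBdd (fun k => a k + b k) := by
  obtain ⟨C, m, hC⟩ := ha
  obtain ⟨D, n, hD⟩ := hb
  have hC0 : 0 ≤ C := by simpa using (norm_nonneg _).trans (hC 0)
  have hD0 : 0 ≤ D := by simpa using (norm_nonneg _).trans (hD 0)
  refine ⟨C + D, m + n, fun k => (norm_add_le _ _).trans ?_⟩
  have h1 : (1 : ℝ) ≤ (k : ℝ) + 1 := by linarith [(Nat.cast_nonneg k : (0 : ℝ) ≤ k)]
  have h2 : ((k : ℝ) + 1) ^ m ≤ ((k : ℝ) + 1) ^ (m + n) := pow_le_pow_right₀ h1 (by omega)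
  have h3 : ((k : ℝ) + 1) ^ n ≤ ((k : ℝ) + 1) ^ (m + n) := pow_le_pow_right₀ h1 (by omega)
  rw [add_mul]
  exact add_le_add ((hC k).trans (by gcongr)) ((hD k).trans (by gcongr))

theorem PolyBdd.const_mul {a : ℕ → ℂ} (ha : PolyBdd a) (c : ℂ) : PolyBdd (fun k => c * a k) :=
  ha.of_le (C := ‖c‖) fun _ => (norm_mul _ _).le

theorem PolyBdd.summable_norm {a : ℕ → ℂ} (ha : PolyBdd a) {z : ℂ} (hz : ‖z‖ < 1) :
    Summable (fun k => ‖a k * z ^ k‖) := by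
  obtain ⟨C, m, hC⟩ := ha.shift
  have h : Summable (fun k : ℕ => C * (((k + 1 : ℕ) : ℝ) ^ m * ‖z‖ ^ (k + 1))) :=
    ((summable_nat_add_iff 1).2 (summable_pow_mul_geometric_of_norm_lt_one m
      (r := ‖z‖) (by simpa using hz))).mul_left C
  refine (summable_nat_add_iff 1).1 (h.of_nonneg_of_le (fun _ => norm_nonneg _) fun k => ?_)
  rw [norm_mul, norm_pow, ← mul_assoc]
  have := hC k
  push_cast
  gcongr

theorem PolyBdd.summable {a : ℕ → ℂ} (ha : PolyBdd a) {z : ℂ} (hz : ‖z‖ < 1) :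
    Summable (fun k => a k * z ^ k) := (ha.summable_norm hz).of_norm

theorem powSum_eq_add {a : ℕ → ℂ} (ha : PolyBdd a) {z : ℂ} (hz : ‖z‖ < 1) :
    powSum a z = a 0 + z * powSum (fun k => a (k + 1)) z := by
  rw [powSum, (ha.summable hz).tsum_eq_zero_add, powSum, ← tsum_mul_left]
  simp only [pow_zero, mul_one, pow_succ]
  congr 1
  exact tsum_congr fun k => by ring

theorem powSum_add {a b : ℕ → ℂ} (ha : PolyBdd a) (hb : PolyBdd b) {z : ℂ} (hz : ‖z‖ < 1) :
    powSum (fun k => a k + b k) z = powSum a z + powSum b z := by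
  simp only [powSum, add_mul]
  exact (ha.summable hz).tsum_add (hb.summable hz)

theorem powSum_const_mul (c : ℂ) (a : ℕ → ℂ) (z : ℂ) :
    powSum (fun k => c * a k) z = c * powSum a z := by
  simp only [powSum, mul_assoc, tsum_mul_left]

theorem powSum_zero (a : ℕ → ℂ) : powSum a 0 = a 0 := by
  rw [powSum, tsum_eq_single 0 (fun k hk => by simp [hk])]
  simp

/-- This turns the difference `w (k + 2) - w k` of the recurrences below into multiplication by `1 -
z ^ 2`. The truncated `k - 1` at `k = 0` is harmless since `w 0 = 0`. -/
theorem one_sub_sq_mul_powSum {w : ℕ → ℂ} (hw : PolyBdd w) (h0 : w 0 = 0) {z : ℂ}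
    (hz : ‖z‖ < 1) : (1 - z ^ 2) * powSum (fun k => w (k + 1)) z
      = powSum (fun k => w (k + 1) + -1 * w (k - 1)) z := by
  have e0 := powSum_eq_add hw hz
  have e1 := powSum_eq_add hw.pred hz
  simp only [zero_tsub, h0, zero_add, Nat.add_sub_cancel] at e0 e1
  rw [powSum_add hw.shift (hw.pred.const_mul _) hz, powSum_const_mul, e1, e0]
  ring

theorem hasDerivAt_powSum {a : ℕ → ℂ} (ha : PolyBdd a) {z : ℂ} (hz : ‖z‖ < 1) :
    HasDerivAt (powSum a) (powSum (fun k => ((k : ℂ) + 1) * a (k + 1)) z) z := by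
  -- Termwise differentiation is justified on the disc of radius `r`, where the derivative series is
  -- dominated by its value at `r`.
  obtain ⟨r, hzr, hr⟩ := exists_between hz
  have hr0 : 0 < r := (norm_nonneg z).trans_lt hzr
  have hd := ha.deriv.summable_norm (z := (r : ℂ)) (by simpa [abs_of_pos hr0] using hr)
  have hu : Summable (fun k : ℕ => ‖a k * (k * (r : ℂ) ^ (k - 1))‖) := by
    refine (summable_nat_add_iff 1).1 (hd.congr fun k => ?_)
    push_cast
    ring_nf
  have key := hasDerivAt_tsum_of_isPreconnected (g := fun k w => a k * w ^ k)
    (g' := fun k w => a k * (k * w ^ (k - 1))) hu (Metric.isOpen_ball (x := (0 : ℂ)) (ε := r))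
    (convex_ball _ _).isPreconnected
    (fun k w _ => (hasDerivAt_pow k w).const_mul (a k))
    (fun k w hw => by
      have hw' : ‖w‖ ≤ ‖(r : ℂ)‖ := by
        simpa [abs_of_pos hr0] using (mem_ball_zero_iff.1 hw).le
      simp only [norm_mul, norm_pow]
      gcongr)
    (Metric.mem_ball_self hr0) (ha.summable (by simp)) (mem_ball_zero_iff.2 hzr)
  convert! key using 1
  have hs : Summable (fun k : ℕ => a k * (k * z ^ (k - 1))) := by
    refine (summable_nat_add_iff 1).1 ((ha.deriv.summable hz).congr fun k => ?_)
    push_cast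
    ring
  rw [hs.tsum_eq_zero_add, powSum]
  simp only [Nat.cast_zero, zero_mul, mul_zero, zero_add, add_tsub_cancel_right]
  exact tsum_congr fun k => by push_cast; ring

theorem hasDerivAt_powSum_ofReal {a : ℕ → ℂ} (ha : PolyBdd a) {x : ℝ} (hx : |x| < 1) :
    HasDerivAt (fun t : ℝ => powSum a t) (powSum (fun k => ((k : ℂ) + 1) * a (k + 1)) x) x :=
  (hasDerivAt_powSum ha (by simpa using hx)).comp_ofReal

theorem continuousAt_powSum_ofReal {a : ℕ → ℂ} (ha : PolyBdd a) {x : ℝ} (hx : |x| < 1) :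
    ContinuousAt (fun t : ℝ => powSum a t) x := (hasDerivAt_powSum_ofReal ha hx).continuousAt

/-! ### Three-term recurrences -/

/-- The solution of `w (k + 2) = w k + t k * w (k + 1)` with initial values `x`, `y`. -/
def threeTerm (t : ℕ → ℂ) (x y : ℂ) : ℕ → ℂ
  | 0 => x
  | 1 => y
  | k + 2 => threeTerm t x y k + t k * threeTerm t x y (k + 1)

/-- One step multiplies the larger modulus of two consecutive terms by at most `1 + ‖t k‖`. -/
theorem norm_threeTerm_le (t : ℕ → ℂ) (x y : ℂ) (k : ℕ) :
    ‖threeTerm t x y k‖ ≤ (∏ j ∈ Finset.range k, (1 + ‖t j‖)) * max ‖x‖ ‖y‖ ∧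
    ‖threeTerm t x y (k + 1)‖ ≤ (∏ j ∈ Finset.range k, (1 + ‖t j‖)) * max ‖x‖ ‖y‖ := by
  induction k with
  | zero => simp [threeTerm]
  | succ k ih =>
    set M := (∏ j ∈ Finset.range k, (1 + ‖t j‖)) * max ‖x‖ ‖y‖ with hM
    have e : (∏ j ∈ Finset.range (k + 1), (1 + ‖t j‖)) * max ‖x‖ ‖y‖ = (1 + ‖t k‖) * M := by
      rw [Finset.prod_range_succ, hM]; ring
    have hM0 : 0 ≤ M := (norm_nonneg _).trans ih.1
    rw [e]
    constructor
    · nlinarith [norm_nonneg (t k), ih.2]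
    · have h1 : ‖threeTerm t x y (k + 1 + 1)‖
          ≤ ‖threeTerm t x y k‖ + ‖t k‖ * ‖threeTerm t x y (k + 1)‖ := by
        rw [threeTerm, ← norm_mul]
        exact norm_add_le _ _
      nlinarith [norm_nonneg (t k), ih.1, ih.2, mul_le_mul_of_nonneg_left ih.2 (norm_nonneg (t k))]

/-- By Bernoulli, `1 + K / (j + 1) ≤ ((j + 2) / (j + 1)) ^ K`, and the product of these telescopes
to `(k + 1) ^ K`. -/
theorem polyBdd_threeTerm {t : ℕ → ℂ} {K : ℕ} (ht : ∀ j, ‖t j‖ ≤ K / ((j : ℝ) + 1)) (x y : ℂ) :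
    PolyBdd (threeTerm t x y) := by
  have hprod : ∀ k : ℕ, ∏ j ∈ Finset.range k, (1 + ‖t j‖) ≤ ((k : ℝ) + 1) ^ K := by
    intro k
    induction k with
    | zero => simp
    | succ k ih =>
      rw [Finset.prod_range_succ]
      have hk : (0 : ℝ) < (k : ℝ) + 1 := by positivity
      have h1 : 1 + ‖t k‖ ≤ (1 + 1 / ((k : ℝ) + 1)) ^ K := by
        have := one_add_mul_le_pow (a := 1 / ((k : ℝ) + 1))
          (by have : 0 ≤ 1 / ((k : ℝ) + 1) := by positivity
              linarith) K
        refine le_trans ?_ this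
        have := ht k
        rw [mul_one_div]
        linarith
      calc _ ≤ ((k : ℝ) + 1) ^ K * (1 + 1 / ((k : ℝ) + 1)) ^ K := by gcongr
        _ = _ := by
          rw [← mul_pow]
          congr 1
          push_cast
          field_simp
  refine ⟨max ‖x‖ ‖y‖, K, fun k => (norm_threeTerm_le t x y k).1.trans ?_⟩
  rw [mul_comm]
  gcongr
  exact hprod k

/-! ### The two solutions of the eigenvalue equation -/

section Sequences

variable (α : ℝ) (lam : ℂ)

/-- The numbers `n v n`, where `v` are the Fourier coefficients of an eigenfunction. -/
noncomputable def uSeq : ℕ → ℂ :=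
  threeTerm (fun j => 2 * α / (j + 1) * (1 - lam / (j + 1))) 0 1

/-- The Fourier coefficients of an eigenfunction. -/
noncomputable def vSeq (n : ℕ) : ℂ := uSeq α lam n / n

/-- The numbers `k (k + α) c k`, where `c` are the Taylor coefficients of the solution regular at
the opposite end point. -/
noncomputable def bSeq : ℕ → ℂ :=
  threeTerm (fun j => -(2 * α * lam) / ((j + 1) * (j + 1 + α))) 0 (-(2 * α * lam))

/-- The Taylor coefficients of the solution that is regular at the opposite end point. -/
noncomputable def cSeq (k : ℕ) : ℂ := if k = 0 then 1 else bSeq α lam k / (k * (k + α))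

/-- The entire function whose zeros are the positive eigenvalues. -/
noncomputable def secular : ℂ := ∑' k, cSeq α lam k

end Sequences

variable {α : ℝ} {lam : ℂ}

theorem uSeq_succ_succ (n : ℕ) : uSeq α lam (n + 2)
    = uSeq α lam n + 2 * α / (n + 1) * (1 - lam / (n + 1)) * uSeq α lam (n + 1) := rfl

theorem bSeq_succ_succ (k : ℕ) : bSeq α lam (k + 2)
    = bSeq α lam k + -(2 * α * lam) / ((k + 1) * (k + 1 + α)) * bSeq α lam (k + 1) := rfl

theorem cSeq_succ (k : ℕ) :
    cSeq α lam (k + 1) = bSeq α lam (k + 1) / ((k + 1) * (k + 1 + α)) := by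
  simp [cSeq]

theorem natCast_add_one_ne (k : ℕ) : (k : ℂ) + 1 ≠ 0 := Nat.cast_add_one_ne_zero k

theorem norm_natCast_add_one (k : ℕ) : ‖(k : ℂ) + 1‖ = (k : ℝ) + 1 := by
  rw [← Nat.cast_succ, Complex.norm_natCast, Nat.cast_succ]

theorem norm_natCast_add_one_add (hα : 0 < α) (k : ℕ) :
    ‖(k : ℂ) + 1 + α‖ = (k : ℝ) + 1 + α := by
  have : (k : ℂ) + 1 + α = (((k : ℝ) + 1 + α : ℝ) : ℂ) := by push_cast; rfl
  rw [this, Complex.norm_real, Real.norm_of_nonneg (by positivity)]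

theorem natCast_add_one_add_ne (hα : 0 < α) (k : ℕ) : (k : ℂ) + 1 + α ≠ 0 := by
  rw [← norm_ne_zero_iff, norm_natCast_add_one_add hα]
  positivity

theorem polyBdd_uSeq (hα : 0 < α) : PolyBdd (uSeq α lam) := by
  obtain ⟨K, hK⟩ := exists_nat_ge (2 * α * (1 + ‖lam‖))
  refine polyBdd_threeTerm (K := K) (fun j => ?_) 0 1
  have hj : (0 : ℝ) < (j : ℝ) + 1 := by positivity
  have h1 : ‖(1 : ℂ) - lam / (j + 1)‖ ≤ 1 + ‖lam‖ := by
    refine (norm_sub_le _ _).trans ?_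
    rw [norm_one, norm_div, norm_natCast_add_one]
    gcongr
    exact div_le_self (norm_nonneg _) (by linarith [(Nat.cast_nonneg j : (0 : ℝ) ≤ j)])
  rw [norm_mul, norm_div, norm_mul, norm_natCast_add_one, Complex.norm_real,
    Real.norm_of_nonneg hα.le]
  simp only [Complex.norm_ofNat]
  calc 2 * α / ((j : ℝ) + 1) * ‖(1 : ℂ) - lam / (j + 1)‖
      ≤ 2 * α / ((j : ℝ) + 1) * (1 + ‖lam‖) := by gcongr
    _ = 2 * α * (1 + ‖lam‖) / ((j : ℝ) + 1) := by ring
    _ ≤ _ := by gcongr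

theorem vSeq_zero : vSeq α lam 0 = 0 := by simp [vSeq]

theorem vSeq_one : vSeq α lam 1 = 1 := by simp [vSeq, uSeq, threeTerm]

theorem add_one_mul_vSeq (n : ℕ) : ((n : ℂ) + 1) * vSeq α lam (n + 1) = uSeq α lam (n + 1) := by
  have := natCast_add_one_ne n
  simp only [vSeq, Nat.cast_add, Nat.cast_one]
  field_simp

theorem polyBdd_vSeq (hα : 0 < α) : PolyBdd (vSeq α lam) := by
  refine (polyBdd_uSeq (lam := lam) hα).of_le (C := 1) fun k => ?_
  rw [vSeq, norm_div, Complex.norm_natCast, one_mul]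
  rcases Nat.eq_zero_or_pos k with rfl | hk
  · simp
  · exact div_le_self (norm_nonneg _) (by exact_mod_cast hk)

theorem hasDerivAt_powSum_vSeq (hα : 0 < α) {z : ℝ} (hz : |z| < 1) :
    HasDerivAt (fun t : ℝ => powSum (vSeq α lam) t)
      (powSum (fun k => uSeq α lam (k + 1)) z) z := by
  have h := hasDerivAt_powSum_ofReal (polyBdd_vSeq (lam := lam) hα) hz
  simpa only [add_one_mul_vSeq] using h

theorem powSum_vSeq (hα : 0 < α) {z : ℝ} (hz : |z| < 1) :
    powSum (vSeq α lam) z = z * powSum (fun k => vSeq α lam (k + 1)) z := by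
  rw [powSum_eq_add (polyBdd_vSeq hα) (by simpa using hz), vSeq_zero, zero_add]

/-- The recurrence for `uSeq` read as the equation `((1 - z ^ 2) g')' = 2 α (g' - lam g / z)`, with
`g' = ∑ u (k + 1) z ^ k` and `g / z = ∑ v (k + 1) z ^ k`. -/
theorem hasDerivAt_one_sub_sq_mul (hα : 0 < α) {z : ℝ} (hz : |z| < 1) :
    HasDerivAt (fun t : ℝ => (1 - (t : ℂ) ^ 2) * powSum (fun k => uSeq α lam (k + 1)) t)
      (2 * α * (powSum (fun k => uSeq α lam (k + 1)) z
        - lam * powSum (fun k => vSeq α lam (k + 1)) z)) z := by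
  have hu := polyBdd_uSeq (lam := lam) hα
  have hv := polyBdd_vSeq (lam := lam) hα
  have hz' : ‖(z : ℂ)‖ < 1 := by simpa using hz
  have h := hasDerivAt_powSum_ofReal (hu.shift.add (hu.pred.const_mul (-1))) hz
  have hE : (fun k : ℕ => ((k : ℂ) + 1) * (uSeq α lam (k + 1 + 1) + -1 * uSeq α lam (k + 1 - 1)))
      = fun k => 2 * α * (uSeq α lam (k + 1) + -lam * vSeq α lam (k + 1)) := by
    funext k
    have := natCast_add_one_ne k
    rw [Nat.add_sub_cancel, uSeq_succ_succ, ← add_one_mul_vSeq]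
    field_simp
    ring
  rw [hE, powSum_const_mul, powSum_add hu.shift (hv.shift.const_mul _) hz',
    powSum_const_mul] at h
  refine (h.congr_of_eventuallyEq ?_).congr_deriv (by ring)
  filter_upwards [(isOpen_lt continuous_abs continuous_const).mem_nhds hz] with t ht
  exact one_sub_sq_mul_powSum hu rfl (by simpa using ht)

/-! ### Bounds on the coefficients of the solution regular at `z = 1` -/

theorem norm_bT_le (hα : 0 < α) (j : ℕ) :
    ‖-(2 * α * lam) / (((j : ℂ) + 1) * (j + 1 + α))‖ ≤ 2 * α * ‖lam‖ / ((j : ℝ) + 1) ^ 2 := by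
  rw [norm_div, norm_neg, norm_mul, norm_mul, norm_mul, norm_natCast_add_one,
    norm_natCast_add_one_add hα, Complex.norm_real, Real.norm_of_nonneg hα.le,
    Complex.norm_ofNat, sq]
  refine div_le_div_of_nonneg_left (by positivity) (by positivity) ?_
  exact mul_le_mul_of_nonneg_left (by linarith) (by positivity)

/-- The exponent `3/4` can be any number strictly between `1/2` and `1`: above `1/2` it keeps `∑ (1
/ j ^ 2) ^ (3/4)` convergent, and below `1` it makes the order of `secular` less than one. -/
theorem one_add_le_exp_rpow {t : ℝ} (ht : 0 ≤ t) :
    1 + t ≤ Real.exp (4 / 3 * t ^ (3 / 4 : ℝ)) := by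
  have h1 : (1 + t) ^ (3 / 4 : ℝ) ≤ 1 + t ^ (3 / 4 : ℝ) := by
    have := Real.rpow_add_le_add_rpow zero_le_one ht (p := 3 / 4) (by norm_num) (by norm_num)
    simpa using this
  have h2 : 1 + t ^ (3 / 4 : ℝ) ≤ Real.exp (t ^ (3 / 4 : ℝ)) := by
    linarith [Real.add_one_le_exp (t ^ (3 / 4 : ℝ))]
  calc 1 + t = ((1 + t) ^ (3 / 4 : ℝ)) ^ (4 / 3 : ℝ) := by
        rw [← Real.rpow_mul (by linarith)]; norm_num
    _ ≤ (Real.exp (t ^ (3 / 4 : ℝ))) ^ (4 / 3 : ℝ) := by gcongr; exact h1.trans h2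
    _ = _ := by rw [← Real.exp_mul, mul_comm]

/-- The recurrence coefficients are `O(‖lam‖ / j ^ 2)`, so the product bounding the sequence
converges, and its growth in `lam` is explicit. The constant `A` depends on neither `k` nor `lam`.
-/
theorem exists_norm_bSeq_le (hα : 0 < α) : ∃ A : ℝ, 0 ≤ A ∧ ∀ (lam : ℂ) (k : ℕ),
    ‖bSeq α lam k‖ ≤ 2 * α * ‖lam‖ * Real.exp (A * ‖lam‖ ^ (3 / 4 : ℝ)) := by
  have hs : Summable (fun j : ℕ => 1 / ((j : ℝ) + 1) ^ (3 / 2 : ℝ)) := by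
    have := (summable_nat_add_iff 1).2 (Real.summable_one_div_nat_rpow.2
      (by norm_num : (1 : ℝ) < 3 / 2))
    simpa using this
  refine ⟨4 / 3 * (2 * α) ^ (3 / 4 : ℝ) * ∑' j : ℕ, 1 / ((j : ℝ) + 1) ^ (3 / 2 : ℝ), ?_, ?_⟩
  · have : 0 ≤ ∑' j : ℕ, 1 / ((j : ℝ) + 1) ^ (3 / 2 : ℝ) := tsum_nonneg fun j => by positivity
    positivity
  intro lam k
  have h := (norm_threeTerm_le (fun j => -(2 * α * lam) / ((j + 1) * (j + 1 + α))) 0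
    (-(2 * α * lam)) k).1
  have hm : max ‖(0 : ℂ)‖ ‖-(2 * α * lam)‖ = 2 * α * ‖lam‖ := by
    rw [norm_zero, norm_neg, norm_mul, norm_mul, Complex.norm_real, Real.norm_of_nonneg hα.le,
      Complex.norm_ofNat, max_eq_right (by positivity)]
  rw [hm] at h
  refine h.trans ?_
  rw [mul_comm]
  gcongr
  calc ∏ j ∈ Finset.range k, (1 + ‖-(2 * α * lam) / (((j : ℂ) + 1) * (j + 1 + α))‖)
      ≤ ∏ j ∈ Finset.range k, Real.exp (4 / 3 * (2 * α * ‖lam‖) ^ (3 / 4 : ℝ)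
          * (1 / ((j : ℝ) + 1) ^ (3 / 2 : ℝ))) := by
        refine Finset.prod_le_prod (fun j _ => by positivity) fun j _ => ?_
        have h1 : 0 ≤ 2 * α * ‖lam‖ / ((j : ℝ) + 1) ^ 2 := by positivity
        have h2 := one_add_le_exp_rpow h1
        have h3 : (2 * α * ‖lam‖ / ((j : ℝ) + 1) ^ 2) ^ (3 / 4 : ℝ)
            = (2 * α * ‖lam‖) ^ (3 / 4 : ℝ) * (1 / ((j : ℝ) + 1) ^ (3 / 2 : ℝ)) := by
          rw [Real.div_rpow (by positivity) (by positivity), ← Real.rpow_natCast _ 2,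
            ← Real.rpow_mul (by positivity)]
          norm_num
          rfl
        rw [h3, ← mul_assoc] at h2
        exact (add_le_add_right (norm_bT_le hα j) 1).trans h2
    _ = Real.exp (4 / 3 * (2 * α * ‖lam‖) ^ (3 / 4 : ℝ)
          * ∑ j ∈ Finset.range k, (1 / ((j : ℝ) + 1) ^ (3 / 2 : ℝ))) := by
        rw [← Real.exp_sum, Finset.mul_sum]
    _ ≤ Real.exp (4 / 3 * (2 * α * ‖lam‖) ^ (3 / 4 : ℝ)
          * ∑' j : ℕ, (1 / ((j : ℝ) + 1) ^ (3 / 2 : ℝ))) := by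
        gcongr
        exact hs.sum_le_tsum _ fun j _ => by positivity
    _ = _ := by
        rw [Real.mul_rpow (by positivity) (norm_nonneg _)]
        ring_nf

theorem norm_cSeq_succ_le (hα : 0 < α) {D : ℝ} {k : ℕ} (h : ‖bSeq α lam (k + 1)‖ ≤ D) :
    ‖cSeq α lam (k + 1)‖ ≤ D * (1 / ((k : ℝ) + 1) ^ 2) := by
  have hD : 0 ≤ D := (norm_nonneg _).trans h
  rw [cSeq_succ, norm_div, norm_mul, norm_natCast_add_one, norm_natCast_add_one_add hα,
    mul_one_div, sq]
  refine div_le_div₀ hD h (by positivity) ?_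
  exact mul_le_mul_of_nonneg_left (by linarith) (by positivity)

theorem summable_one_div_add_one_sq : Summable (fun k : ℕ => 1 / ((k : ℝ) + 1) ^ 2) := by
  have := (summable_nat_add_iff 1).2 (Real.summable_one_div_nat_pow.2 (by norm_num : 1 < 2))
  simpa using this

theorem summable_norm_cSeq (hα : 0 < α) : Summable (fun k => ‖cSeq α lam k‖) := by
  obtain ⟨A, -, hA⟩ := exists_norm_bSeq_le hα
  exact (summable_nat_add_iff 1).1 ((summable_one_div_add_one_sq.mul_left _).of_nonneg_of_le
    (fun _ => norm_nonneg _) fun k => norm_cSeq_succ_le hα (hA lam _))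

theorem polyBdd_bSeq (hα : 0 < α) : PolyBdd (bSeq α lam) := by
  obtain ⟨A, -, hA⟩ := exists_norm_bSeq_le hα
  exact ⟨_, 0, fun k => by simpa using hA lam k⟩

theorem polyBdd_cSeq (hα : 0 < α) : PolyBdd (cSeq α lam) :=
  ⟨∑' k, ‖cSeq α lam k‖, 0, fun k => by
    simpa using (summable_norm_cSeq hα).le_tsum k fun _ _ => norm_nonneg _⟩

/-- The Taylor coefficients of the derivative of the regular solution. -/
noncomputable def dSeq (α : ℝ) (lam : ℂ) (k : ℕ) : ℂ := bSeq α lam (k + 1) / (k + 1 + α)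

theorem add_one_mul_cSeq (hα : 0 < α) (k : ℕ) :
    ((k : ℂ) + 1) * cSeq α lam (k + 1) = dSeq α lam k := by
  have := natCast_add_one_ne k
  have := natCast_add_one_add_ne hα k
  rw [cSeq_succ, dSeq]
  field_simp

theorem polyBdd_dSeq (hα : 0 < α) : PolyBdd (dSeq α lam) := by
  have := (polyBdd_cSeq (lam := lam) hα).deriv
  simpa only [add_one_mul_cSeq hα] using this

theorem hasDerivAt_powSum_cSeq (hα : 0 < α) {x : ℝ} (hx : |x| < 1) :
    HasDerivAt (fun t : ℝ => powSum (cSeq α lam) t) (powSum (dSeq α lam) x) x := by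
  have h := hasDerivAt_powSum_ofReal (polyBdd_cSeq (lam := lam) hα) hx
  simpa only [add_one_mul_cSeq hα] using h

/-- For `f = ∑ c k x ^ k` this is `x f'' + (1 + α) f' = ∑ b (k + 1) x ^ k`. Together with
`one_sub_sq_mul_powSum_bSeq` it gives the equation `(1 - x ^ 2) (x f'' + (1 + α) f') = -2 α lam f`.
-/
theorem mul_powSum_deriv_dSeq (hα : 0 < α) {x : ℂ} (hx : ‖x‖ < 1) :
    x * powSum (fun k => ((k : ℂ) + 1) * dSeq α lam (k + 1)) x
      + (1 + α) * powSum (dSeq α lam) x = powSum (fun k => bSeq α lam (k + 1)) x := by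
  have hd := polyBdd_dSeq (lam := lam) hα
  have h1 : PolyBdd (fun k => (k : ℂ) * dSeq α lam k) := by
    refine (hd.deriv.pred).of_le (C := 1) fun k => ?_
    rcases k with _ | k <;> simp
  have h2 := powSum_eq_add h1 hx
  simp only [Nat.cast_zero, zero_mul, zero_add, Nat.cast_add, Nat.cast_one] at h2
  rw [← h2, ← powSum_const_mul, ← powSum_add h1 (hd.const_mul _) hx]
  congr 1
  funext k
  have := natCast_add_one_add_ne hα k
  rw [dSeq]
  field_simp
  ring

theorem one_sub_sq_mul_powSum_bSeq (hα : 0 < α) {x : ℂ} (hx : ‖x‖ < 1) :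
    (1 - x ^ 2) * powSum (fun k => bSeq α lam (k + 1)) x
      = -(2 * α * lam) * powSum (cSeq α lam) x := by
  rw [one_sub_sq_mul_powSum (polyBdd_bSeq hα) rfl hx, ← powSum_const_mul]
  congr 1
  funext k
  rcases k with _ | k
  · simp [bSeq, threeTerm, cSeq]
  · rw [bSeq_succ_succ, cSeq_succ, Nat.add_sub_cancel]
    ring

/-! ### The secular function -/

section Secular

variable {α : ℝ} {lam : ℂ}

theorem differentiable_threeTerm {t : ℕ → ℂ → ℂ} {x y : ℂ → ℂ} (ht : ∀ j, Differentiable ℂ (t j))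
    (hx : Differentiable ℂ x) (hy : Differentiable ℂ y) (k : ℕ) :
    Differentiable ℂ (fun w => threeTerm (fun j => t j w) (x w) (y w) k) ∧
    Differentiable ℂ (fun w => threeTerm (fun j => t j w) (x w) (y w) (k + 1)) := by
  induction k with
  | zero => exact ⟨hx, hy⟩
  | succ k ih => exact ⟨ih.2, ih.1.add ((ht k).mul ih.2)⟩

theorem differentiable_cSeq (k : ℕ) : Differentiable ℂ (fun w => cSeq α w k) := by
  rcases k with _ | k
  · simp [cSeq]
  · simp only [cSeq_succ]
    refine Differentiable.div_const ?_ _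
    exact (differentiable_threeTerm (t := fun j w => -(2 * α * w) / ((j + 1) * (j + 1 + α)))
      (x := fun _ => 0) (y := fun w => -(2 * α * w)) (fun j => by fun_prop) (by fun_prop)
      (by fun_prop) k).2

/-- The bound on `bSeq` is uniform on discs, so the Weierstrass test applies to the series of
polynomials `cSeq`. -/
theorem differentiable_secular (hα : 0 < α) : Differentiable ℂ (secular α) := by
  obtain ⟨A, hA0, hA⟩ := exists_norm_bSeq_le hα
  intro w
  set R := ‖w‖ + 1
  have hR : 0 < R := by positivity
  have hs : Summable (fun k : ℕ => if k = 0 then 1 else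
      2 * α * R * Real.exp (A * R ^ (3 / 4 : ℝ)) * (1 / (k : ℝ) ^ 2)) := by
    refine (summable_nat_add_iff 1).1 ?_
    simpa using summable_one_div_add_one_sq.mul_left (2 * α * R * Real.exp (A * R ^ (3 / 4 : ℝ)))
  have h := Complex.differentiableOn_tsum_of_summable_norm (F := fun k w => cSeq α w k)
    (U := Metric.ball 0 R) hs (fun k => (differentiable_cSeq k).differentiableOn)
    Metric.isOpen_ball (fun k z hz => by
      have hz' : ‖z‖ ≤ R := (mem_ball_zero_iff.1 hz).le
      rcases k with _ | k
      · simp [cSeq]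
      · have : ‖bSeq α z (k + 1)‖ ≤ 2 * α * R * Real.exp (A * R ^ (3 / 4 : ℝ)) :=
          (hA z (k + 1)).trans (by gcongr)
        simpa using norm_cSeq_succ_le hα this)
  exact h.differentiableAt (Metric.isOpen_ball.mem_nhds (by simp [R]))

theorem norm_secular_le (hα : 0 < α) : ∃ A : ℝ, 0 < A ∧ ∀ w : ℂ,
    ‖secular α w‖ ≤ Real.exp (A * (1 + ‖w‖ ^ (3 / 4 : ℝ))) := by
  obtain ⟨A, hA0, hA⟩ := exists_norm_bSeq_le hα
  set Z := ∑' k : ℕ, 1 / ((k : ℝ) + 1) ^ 2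
  have hZ : 0 ≤ Z := tsum_nonneg fun k => by positivity
  refine ⟨4 / 3 * (2 * α * Z) ^ (3 / 4 : ℝ) + A + 1, by positivity, fun w => ?_⟩
  set E := Real.exp (A * ‖w‖ ^ (3 / 4 : ℝ)) with hE
  have hE1 : 1 ≤ E := Real.one_le_exp (by positivity)
  have h1 : ‖secular α w‖ ≤ 1 + 2 * α * ‖w‖ * E * Z := by
    have hs := summable_norm_cSeq (lam := w) hα
    calc ‖secular α w‖ ≤ ∑' k, ‖cSeq α w k‖ := norm_tsum_le_tsum_norm hs
      _ = 1 + ∑' k, ‖cSeq α w (k + 1)‖ := by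
        rw [hs.tsum_eq_zero_add]; simp [cSeq]
      _ ≤ _ := by
        gcongr
        rw [← tsum_mul_left]
        exact ((summable_nat_add_iff 1).2 hs).tsum_le_tsum
          (fun k => norm_cSeq_succ_le hα (hA w _)) (summable_one_div_add_one_sq.mul_left _)
  have h2 := one_add_le_exp_rpow (t := 2 * α * Z * ‖w‖) (by positivity)
  rw [Real.mul_rpow (by positivity) (norm_nonneg w)] at h2
  calc ‖secular α w‖ ≤ (1 + 2 * α * Z * ‖w‖) * E := by nlinarith
    _ ≤ Real.exp (4 / 3 * ((2 * α * Z) ^ (3 / 4 : ℝ) * ‖w‖ ^ (3 / 4 : ℝ))) * E := by gcongr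
    _ ≤ _ := by
      rw [hE, ← Real.exp_add]
      gcongr
      have : 0 ≤ ‖w‖ ^ (3 / 4 : ℝ) := by positivity
      have : 0 ≤ (2 * α * Z) ^ (3 / 4 : ℝ) := by positivity
      nlinarith

/-- For `lam = -s` every coefficient of the recurrence and the initial value `2 α s` are
nonnegative, so no cancellation occurs on the negative axis. -/
theorem bSeq_neg_nonneg (hα : 0 < α) {s : ℝ} (hs : 0 ≤ s) (k : ℕ) :
    (∃ r : ℝ, 0 ≤ r ∧ bSeq α (-s) k = r) ∧ ∃ r : ℝ, 0 ≤ r ∧ bSeq α (-s) (k + 1) = r := by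
  induction k with
  | zero =>
    exact ⟨⟨0, le_rfl, by simp [bSeq, threeTerm]⟩,
      ⟨2 * α * s, by positivity, by simp [bSeq, threeTerm]⟩⟩
  | succ k ih =>
    obtain ⟨⟨r₁, h₁, e₁⟩, r₂, h₂, e₂⟩ := ih
    refine ⟨⟨r₂, h₂, e₂⟩, r₁ + 2 * α * s / ((k + 1) * (k + 1 + α)) * r₂, by positivity, ?_⟩
    rw [bSeq_succ_succ, e₁, e₂]
    push_cast
    ring

/-- Keeping only the `t k * b (k + 1)` term of the recurrence gains one power of `s` at each step.
-/
theorem exists_le_bSeq_neg (hα : 0 < α) (k : ℕ) : ∃ c : ℝ, 0 < c ∧ ∀ s : ℝ, 0 ≤ s →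
    c * s ^ (k + 1) ≤ (bSeq α (-s) (k + 1)).re := by
  induction k with
  | zero => exact ⟨2 * α, by positivity, fun s _ => by simp [bSeq, threeTerm]⟩
  | succ k ih =>
    obtain ⟨c, hc, h⟩ := ih
    refine ⟨2 * α / ((k + 1) * (k + 1 + α)) * c, by positivity, fun s hs => ?_⟩
    obtain ⟨⟨r₁, h₁, e₁⟩, r₂, h₂, e₂⟩ := bSeq_neg_nonneg hα hs k
    have hr := h s hs
    rw [e₂, Complex.ofReal_re] at hr
    have e : bSeq α (-s) (k + 2)
        = ((r₁ + 2 * α * s / ((k + 1) * (k + 1 + α)) * r₂ : ℝ) : ℂ) := by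
      rw [bSeq_succ_succ, e₁, e₂]
      push_cast
      ring
    rw [e, Complex.ofReal_re]
    calc 2 * α / ((k + 1) * (k + 1 + α)) * c * s ^ (k + 1 + 1)
        = 2 * α * s / ((k + 1) * (k + 1 + α)) * (c * s ^ (k + 1)) := by ring
      _ ≤ 2 * α * s / ((k + 1) * (k + 1 + α)) * r₂ := by gcongr
      _ ≤ _ := by linarith

theorem cSeq_succ_neg_re (hα : 0 < α) {s : ℝ} (hs : 0 ≤ s) (k : ℕ) :
    (cSeq α (-s) (k + 1)).re = (bSeq α (-s) (k + 1)).re / ((k + 1) * (k + 1 + α)) := by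
  obtain ⟨r, -, e⟩ := (bSeq_neg_nonneg hα hs k).2
  have : cSeq α (-s) (k + 1) = ((r / ((k + 1) * (k + 1 + α)) : ℝ) : ℂ) := by
    rw [cSeq_succ, e]; push_cast; rfl
  rw [this, e, Complex.ofReal_re, Complex.ofReal_re]

/-- All terms of the series are nonnegative here, so the sum dominates the term `1` of index `0`
plus any single later term. -/
theorem one_add_le_secular_neg_re (hα : 0 < α) {s : ℝ} (hs : 0 ≤ s) (k : ℕ) :
    1 + (bSeq α (-s) (k + 1)).re / ((k + 1) * (k + 1 + α)) ≤ (secular α (-s)).re := by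
  have hsum := (summable_norm_cSeq (α := α) (lam := -s) hα).of_norm
  have hre : Summable (fun k => (cSeq α (-s) k).re) := Complex.reCLM.summable hsum
  rw [secular, Complex.re_tsum hsum, hre.tsum_eq_zero_add, ← cSeq_succ_neg_re hα hs]
  have h0 : (cSeq α (-s) 0).re = 1 := by simp [cSeq]
  rw [h0]
  gcongr
  refine ((summable_nat_add_iff 1).2 hre).le_tsum k fun j _ => ?_
  rw [cSeq_succ_neg_re hα hs]
  obtain ⟨r, hr, e⟩ := (bSeq_neg_nonneg hα hs j).2
  rw [e, Complex.ofReal_re]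
  positivity

theorem one_le_secular_neg_re (hα : 0 < α) {s : ℝ} (hs : 0 ≤ s) : 1 ≤ (secular α (-s)).re := by
  refine le_trans ?_ (one_add_le_secular_neg_re hα hs 0)
  obtain ⟨r, hr, e⟩ := (bSeq_neg_nonneg hα hs 0).2
  rw [e, Complex.ofReal_re]
  have : 0 ≤ r / (((0 : ℕ) + 1) * ((0 : ℕ) + 1 + α)) := by positivity
  linarith

theorem infinite_zeros_secular (hα : 0 < α) : {w | secular α w = 0}.Infinite := by
  obtain ⟨A, hA, hup⟩ := norm_secular_le hα
  refine infinite_zeros_of_growth (differentiable_secular hα) hA (by norm_num) (by norm_num) hup ?_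
  intro d
  rcases d with _ | k
  · refine ⟨1, one_pos, fun s hs => ?_⟩
    rw [pow_zero, mul_one]
    exact (one_le_secular_neg_re hα hs).trans (Complex.re_le_norm _)
  · obtain ⟨c, hc, h⟩ := exists_le_bSeq_neg hα k
    refine ⟨c / ((k + 1) * (k + 1 + α)), by positivity, fun s hs => ?_⟩
    refine le_trans ?_ ((one_add_le_secular_neg_re hα hs k).trans (Complex.re_le_norm _))
    calc c / ((k + 1) * (k + 1 + α)) * s ^ (k + 1)
        = c * s ^ (k + 1) / ((k + 1) * (k + 1 + α)) := by ring
      _ ≤ (bSeq α (-s) (k + 1)).re / ((k + 1) * (k + 1 + α)) := by gcongr; exact h s hs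
      _ ≤ _ := by linarith

end Secular

/-! ### The Wronskian of the two solutions -/

section Wronskian

variable {α : ℝ} {lam : ℂ}

/-- The Cayley transform interchanging the end points of `(0, 1)`. -/
noncomputable def cayley (z : ℝ) : ℝ := (1 - z) / (1 + z)

theorem cayley_pos {z : ℝ} (h : z ∈ Ioo (0 : ℝ) 1) : 0 < cayley z :=
  div_pos (by linarith [h.2]) (by linarith [h.1])

theorem cayley_lt_one {z : ℝ} (h : z ∈ Ioo (0 : ℝ) 1) : cayley z < 1 := by
  rw [cayley, div_lt_one (by linarith [h.1])]
  linarith [h.1]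

theorem abs_cayley_lt_one {z : ℝ} (h : z ∈ Ioo (0 : ℝ) 1) : |cayley z| < 1 := by
  rw [abs_of_pos (cayley_pos h)]
  exact cayley_lt_one h

theorem abs_lt_one_of_mem {z : ℝ} (h : z ∈ Ioo (0 : ℝ) 1) : |z| < 1 := by
  rw [abs_of_pos h.1]; exact h.2

theorem cayley_le {z : ℝ} (h : z ∈ Ioo (0 : ℝ) 1) : cayley z ≤ 1 - z :=
  div_le_self (by linarith [h.2]) (by linarith [h.1])

theorem hasDerivAt_cayley {z : ℝ} (h : -1 < z) :
    HasDerivAt cayley (-2 / (1 + z) ^ 2) z := by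
  have h1 : 1 + z ≠ 0 := by linarith
  have := ((hasDerivAt_id z).const_sub 1).div ((hasDerivAt_id z).const_add 1) h1
  convert! this using 1
  simp
  ring

theorem tendsto_cayley_zero : Tendsto cayley (𝓝[>] 0) (𝓝[<] 1) := by
  refine tendsto_nhdsWithin_iff.2 ⟨?_, ?_⟩
  · have := (hasDerivAt_cayley (z := 0) (by norm_num)).continuousAt.tendsto
    simp only [cayley] at this
    norm_num at this
    exact this.mono_left nhdsWithin_le_nhds
  · filter_upwards [Ioo_mem_nhdsGT one_pos] with z hz
    exact cayley_lt_one hz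

theorem tendsto_cayley_one : Tendsto cayley (𝓝[<] 1) (𝓝 0) := by
  have := (hasDerivAt_cayley (z := 1) (by norm_num)).continuousAt.tendsto
  simp only [cayley] at this
  norm_num at this
  exact this.mono_left nhdsWithin_le_nhds

theorem hasDerivAt_cayley_rpow {z : ℝ} (h : z ∈ Ioo (0 : ℝ) 1) :
    HasDerivAt (fun t => cayley t ^ α) (-2 * α / (1 - z ^ 2) * cayley z ^ α) z := by
  have h1 := (hasDerivAt_cayley (z := z) (by linarith [h.1])).rpow_const (p := α)
    (Or.inl (cayley_pos h).ne')
  refine h1.congr_deriv ?_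
  rw [Real.rpow_sub_one (cayley_pos h).ne']
  have e1 : 1 + z ≠ 0 := by linarith [h.1]
  have e2 : 1 - z ≠ 0 := by linarith [h.2]
  have e3 : 1 - z ^ 2 ≠ 0 := by
    have : 1 - z ^ 2 = (1 - z) * (1 + z) := by ring
    rw [this]; positivity
  have : cayley z = (1 - z) / (1 + z) := rfl
  generalize cayley z ^ α = r
  rw [this]
  field_simp
  ring

/-- The function `p g'`, where `p` makes the differential equation formally self-adjoint. -/
noncomputable def fluxSum (α : ℝ) (lam : ℂ) (z : ℝ) : ℂ :=
  ((cayley z ^ α : ℝ) : ℂ) * ((1 - (z : ℂ) ^ 2) * powSum (fun k => uSeq α lam (k + 1)) z)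

/-- The Wronskian of the two solutions. -/
noncomputable def wronskian (α : ℝ) (lam : ℂ) (z : ℝ) : ℂ :=
  powSum (cSeq α lam) (cayley z) * fluxSum α lam z
    + 2 * ((cayley z : ℂ) * ((cayley z ^ α : ℝ) : ℂ) * powSum (dSeq α lam) (cayley z))
      * powSum (vSeq α lam) z

theorem one_add_ne {z : ℝ} (h : z ∈ Ioo (0 : ℝ) 1) : 1 + (z : ℂ) ≠ 0 := by
  have : ((1 + z : ℝ) : ℂ) ≠ 0 := Complex.ofReal_ne_zero.2 (by linarith [h.1])
  simpa using this

theorem one_sub_ne {z : ℝ} (h : z ∈ Ioo (0 : ℝ) 1) : 1 - (z : ℂ) ≠ 0 := by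
  have : ((1 - z : ℝ) : ℂ) ≠ 0 := Complex.ofReal_ne_zero.2 (by linarith [h.2])
  simpa using this

theorem one_sub_sq_ne {z : ℝ} (h : z ∈ Ioo (0 : ℝ) 1) : 1 - (z : ℂ) ^ 2 ≠ 0 := by
  have : 1 - (z : ℂ) ^ 2 = (1 - z) * (1 + z) := by ring
  rw [this]
  exact mul_ne_zero (one_sub_ne h) (one_add_ne h)

theorem cayley_ofReal (z : ℝ) : (cayley z : ℂ) = (1 - z) / (1 + z) := by
  simp [cayley]

/-- The weight `cayley z ^ α` is the integrating factor that absorbs the term `2 α g'` and leaves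
the self-adjoint form. -/
theorem hasDerivAt_fluxSum (hα : 0 < α) {z : ℝ} (h : z ∈ Ioo (0 : ℝ) 1) :
    HasDerivAt (fluxSum α lam) (-2 * α * lam * ((cayley z ^ α : ℝ) : ℂ)
      * powSum (fun k => vSeq α lam (k + 1)) z) z := by
  have h1 := (hasDerivAt_cayley_rpow (α := α) h).ofReal_comp
  have h2 := hasDerivAt_one_sub_sq_mul (lam := lam) hα (abs_lt_one_of_mem h)
  refine (h1.mul h2).congr_deriv ?_
  have := one_sub_sq_ne h
  push_cast
  field_simp
  ring

theorem hasDerivAt_powSum_cSeq_cayley (hα : 0 < α) {z : ℝ} (h : z ∈ Ioo (0 : ℝ) 1) :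
    HasDerivAt (fun t => powSum (cSeq α lam) (cayley t))
      (powSum (dSeq α lam) (cayley z) * (-2 / (1 + z) ^ 2)) z := by
  have h1 := (hasDerivAt_powSum_cSeq (lam := lam) hα (abs_cayley_lt_one h)).scomp z
    (hasDerivAt_cayley (z := z) (by linarith [h.1]))
  refine h1.congr_deriv ?_
  rw [Complex.real_smul]
  push_cast
  ring

theorem hasDerivAt_wronskian (hα : 0 < α) {z : ℝ} (h : z ∈ Ioo (0 : ℝ) 1) :
    HasDerivAt (wronskian α lam) 0 z := by
  have hx := abs_cayley_lt_one h
  have h1 := (hasDerivAt_cayley_rpow (α := α) h).ofReal_comp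
  have h2 := (hasDerivAt_cayley (z := z) (by linarith [h.1])).ofReal_comp
  have h3 := hasDerivAt_powSum_cSeq_cayley (lam := lam) hα h
  have h4 := (hasDerivAt_powSum_ofReal (polyBdd_dSeq (lam := lam) hα) hx).scomp z
    (hasDerivAt_cayley (z := z) (by linarith [h.1]))
  have h5 := hasDerivAt_powSum_vSeq (lam := lam) hα (abs_lt_one_of_mem h)
  have h6 := hasDerivAt_fluxSum (lam := lam) hα h
  have key := (h3.mul h6).add ((((h2.mul h1).mul h4).const_mul 2).mul h5)
  refine key.congr_deriv ?_
  have e1 := mul_powSum_deriv_dSeq (lam := lam) hα (x := cayley z) (by simpa using hx)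
  have e2 := one_sub_sq_mul_powSum_bSeq (lam := lam) hα (x := cayley z) (by simpa using hx)
  have e3 := powSum_vSeq (lam := lam) hα (abs_lt_one_of_mem h)
  simp only [Pi.mul_apply, Function.comp_apply, Complex.real_smul, fluxSum]
  push_cast
  rw [e3]
  rw [← e1] at e2
  have hz1 := one_add_ne h
  have hz2 := one_sub_ne h
  have hz3 := one_sub_sq_ne h
  rw [cayley_ofReal] at e2 ⊢
  generalize ((cayley z ^ α : ℝ) : ℂ) = r
  generalize powSum (fun k => ((k : ℂ) + 1) * dSeq α lam (k + 1)) ((1 - (z : ℂ)) / (1 + z)) = D at *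
  generalize powSum (dSeq α lam) ((1 - (z : ℂ)) / (1 + z)) = d at *
  generalize powSum (cSeq α lam) ((1 - (z : ℂ)) / (1 + z)) = c at *
  generalize powSum (fun k => vSeq α lam (k + 1)) (z : ℂ) = V at *
  generalize powSum (fun k => uSeq α lam (k + 1)) (z : ℂ) = U at *
  have e4 : 1 - ((1 - (z : ℂ)) / (1 + z)) ^ 2 = 4 * z / (1 + z) ^ 2 := by field_simp; ring
  rw [e4] at e2
  -- The equation of the solution regular at `z = 1`, after substituting `1 - x ^ 2 = 4 z / (1 + z)
  -- ^ 2`. The identities `e6` and `e7` match the derivatives of the weight and of `x` with the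
  -- factor `1 - z ^ 2`.
  have e5 : (z : ℂ) * (-2 / (1 + z) ^ 2) * ((1 - (z : ℂ)) / (1 + z) * D + (1 + α) * d)
      = α * lam * c := by
    linear_combination (-1 / 2) * e2
  have e6 : -2 * (α : ℂ) / (1 - z ^ 2) * ((1 - (z : ℂ)) / (1 + z)) = -2 * α / (1 + z) ^ 2 := by
    have : 1 - (z : ℂ) ^ 2 = (1 - z) * (1 + z) := by ring
    rw [this]; field_simp
  have e7 : (-2 / (1 + (z : ℂ)) ^ 2) * (1 - z ^ 2) = -2 * ((1 - (z : ℂ)) / (1 + z)) := by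
    have : 1 - (z : ℂ) ^ 2 = (1 - z) * (1 + z) := by ring
    rw [this]; field_simp
  linear_combination 2 * r * V * e5 + 2 * r * d * z * V * e6 + d * r * U * e7

theorem wronskian_eq (hα : 0 < α) {z w : ℝ} (hz : z ∈ Ioo (0 : ℝ) 1) (hw : w ∈ Ioo (0 : ℝ) 1) :
    wronskian α lam z = wronskian α lam w :=
  isOpen_Ioo.is_const_of_deriv_eq_zero isPreconnected_Ioo
    (fun _ ht => (hasDerivAt_wronskian hα ht).differentiableAt.differentiableWithinAt)
    (fun _ ht => (hasDerivAt_wronskian hα ht).deriv) hz hw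

/-- The coefficients are absolutely summable, so the series converges up to `x = 1` by dominated
convergence. -/
theorem tendsto_powSum_cSeq_one (hα : 0 < α) :
    Tendsto (fun x : ℝ => powSum (cSeq α lam) x) (𝓝[<] 1) (𝓝 (secular α lam)) := by
  refine tendsto_tsum_of_dominated_convergence (summable_norm_cSeq (lam := lam) hα)
    (fun k => ?_) ?_
  · have : Tendsto (fun x : ℝ => cSeq α lam k * (x : ℂ) ^ k) (𝓝 1)
        (𝓝 (cSeq α lam k * ((1 : ℝ) : ℂ) ^ k)) := by
      apply Continuous.tendsto
      fun_prop
    simpa using this.mono_left nhdsWithin_le_nhds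
  · filter_upwards [Ioo_mem_nhdsLT (zero_lt_one' ℝ)] with x hx k
    rw [norm_mul, norm_pow]
    refine mul_le_of_le_one_right (norm_nonneg _) (pow_le_one₀ (norm_nonneg _) ?_)
    simpa using (abs_lt_one_of_mem hx).le

theorem one_sub_mul_pow_le {x : ℝ} (hx : x ∈ Ioo (0 : ℝ) 1) (k : ℕ) :
    (1 - x) * x ^ k ≤ 1 / ((k : ℝ) + 1) := by
  rw [le_div_iff₀ (by positivity)]
  have h1 : (1 - x) * ∑ j ∈ Finset.range (k + 1), x ^ j = 1 - x ^ (k + 1) := by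
    have := mul_neg_geom_sum x (k + 1)
    linarith
  have h2 : ((k : ℝ) + 1) * x ^ k ≤ ∑ j ∈ Finset.range (k + 1), x ^ j := by
    have : ∑ j ∈ Finset.range (k + 1), x ^ k ≤ ∑ j ∈ Finset.range (k + 1), x ^ j :=
      Finset.sum_le_sum fun j hj => pow_le_pow_of_le_one hx.1.le hx.2.le
        (Nat.lt_succ_iff.1 (Finset.mem_range.1 hj))
    simpa using this
  have h3 : 0 < 1 - x := by linarith [hx.2]
  have h4 : 0 < x ^ (k + 1) := pow_pos hx.1 _
  nlinarith

/-- The coefficients are only `O(1 / k)`, so `f'` need not be bounded at `x = 1`. Since `(1 - x) x ^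
k ≤ 1 / (k + 1)`, the factor `1 - x` yields the summable majorant `D / (k + 1) ^ 2`. -/
theorem tendsto_one_sub_mul_powSum_dSeq (hα : 0 < α) :
    Tendsto (fun x : ℝ => (1 - (x : ℂ)) * powSum (dSeq α lam) x) (𝓝[<] 1) (𝓝 0) := by
  obtain ⟨A, -, hA⟩ := exists_norm_bSeq_le hα
  obtain ⟨D, hD⟩ : ∃ D, ∀ k, ‖bSeq α lam k‖ ≤ D := ⟨_, hA lam⟩
  have hd : ∀ k, ‖dSeq α lam k‖ ≤ D * (1 / ((k : ℝ) + 1)) := by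
    intro k
    have hD0 := (norm_nonneg _).trans (hD (k + 1))
    rw [dSeq, norm_div, norm_natCast_add_one_add hα, mul_one_div]
    exact div_le_div₀ hD0 (hD (k + 1)) (by positivity) (by linarith)
  have h : Tendsto (fun x : ℝ => ∑' k, (1 - (x : ℂ)) * (dSeq α lam k * (x : ℂ) ^ k)) (𝓝[<] 1)
      (𝓝 (∑' _ : ℕ, (0 : ℂ))) := by
    refine tendsto_tsum_of_dominated_convergence (summable_one_div_add_one_sq.mul_left D)
      (fun k => ?_) ?_
    · have : Tendsto (fun x : ℝ => (1 - (x : ℂ)) * (dSeq α lam k * (x : ℂ) ^ k)) (𝓝 1)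
          (𝓝 ((1 - ((1 : ℝ) : ℂ)) * (dSeq α lam k * ((1 : ℝ) : ℂ) ^ k))) := by
        apply Continuous.tendsto
        fun_prop
      simpa using this.mono_left nhdsWithin_le_nhds
    · filter_upwards [Ioo_mem_nhdsLT (zero_lt_one' ℝ)] with x hx k
      have e : ‖(1 - (x : ℂ)) * (dSeq α lam k * (x : ℂ) ^ k)‖
          = ‖dSeq α lam k‖ * ((1 - x) * x ^ k) := by
        have : (1 - (x : ℂ)) = ((1 - x : ℝ) : ℂ) := by push_cast; rfl
        rw [this, norm_mul, norm_mul, norm_pow, Complex.norm_real, Complex.norm_real,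
          Real.norm_of_nonneg hx.1.le, Real.norm_of_nonneg (by linarith [hx.2])]
        ring
      rw [e]
      have h0 : 0 ≤ (1 - x) * x ^ k := mul_nonneg (by linarith [hx.2]) (pow_nonneg hx.1.le _)
      have h1 := mul_le_mul (hd k) (one_sub_mul_pow_le hx k) h0
        ((norm_nonneg _).trans (hd k))
      refine h1.trans (le_of_eq ?_)
      field_simp
  simpa [powSum, tsum_mul_left] using h

/-- At `z = 0` the flux `p g'` tends to `1` and `f` tends to `secular`. The other term vanishes
because `g` is of order `z`, hence of order `1 - x`, which beats the possible growth of `f'`. -/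
theorem tendsto_wronskian_zero (hα : 0 < α) :
    Tendsto (wronskian α lam) (𝓝[>] 0) (𝓝 (secular α lam)) := by
  have hx0 : cayley 0 = 1 := by simp [cayley]
  have hc : ContinuousAt cayley 0 := (hasDerivAt_cayley (z := 0) (by norm_num)).continuousAt
  have h1 := (tendsto_powSum_cSeq_one (lam := lam) hα).comp tendsto_cayley_zero
  have hr : ContinuousAt (fun z => ((cayley z ^ α : ℝ) : ℂ)) 0 :=
    Complex.continuous_ofReal.continuousAt.comp
      (hc.rpow_const (Or.inl (by rw [hx0]; norm_num)))
  have hU := continuousAt_powSum_ofReal (polyBdd_uSeq (lam := lam) hα).shift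
    (x := 0) (by simp)
  have hV := continuousAt_powSum_ofReal (polyBdd_vSeq (lam := lam) hα).shift
    (x := 0) (by simp)
  have hz : ContinuousAt (fun z : ℝ => (z : ℂ)) 0 := Complex.continuous_ofReal.continuousAt
  have h2 : Tendsto (fluxSum α lam) (𝓝[>] 0) (𝓝 1) := by
    have h : ContinuousAt (fluxSum α lam) 0 :=
      hr.mul ((continuousAt_const.sub (hz.pow 2)).mul hU)
    have h0 : fluxSum α lam 0 = 1 := by simp [fluxSum, hx0, powSum_zero, uSeq, threeTerm]
    rw [← h0]
    exact h.tendsto.mono_left nhdsWithin_le_nhds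
  have h3 := (tendsto_one_sub_mul_powSum_dSeq (lam := lam) hα).comp tendsto_cayley_zero
  have h4 : Tendsto (fun z : ℝ => (cayley z : ℂ) * ((cayley z ^ α : ℝ) : ℂ)
      * (powSum (fun k => vSeq α lam (k + 1)) z * (1 + z))) (𝓝[>] 0) (𝓝 1) := by
    have h : ContinuousAt (fun z : ℝ => (cayley z : ℂ) * ((cayley z ^ α : ℝ) : ℂ)
        * (powSum (fun k => vSeq α lam (k + 1)) z * (1 + z))) 0 :=
      ((Complex.continuous_ofReal.continuousAt.comp hc).mul hr).mul
        (hV.mul (continuousAt_const.add hz))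
    have h0 := h.tendsto.mono_left (nhdsWithin_le_nhds (s := Ioi 0))
    simpa [hx0, powSum_zero, vSeq_one] using h0
  have h5 := (h1.mul h2).add (h3.mul h4)
  simp only [mul_one, add_zero] at h5
  refine h5.congr' ?_
  filter_upwards [Ioo_mem_nhdsGT one_pos] with z hz
  have e3 := powSum_vSeq (lam := lam) hα (abs_lt_one_of_mem hz)
  have e : (1 - (cayley z : ℂ)) * (1 + z) = 2 * z := by
    have := one_add_ne hz
    rw [cayley_ofReal]
    field_simp
    ring
  simp only [wronskian, Function.comp_apply, e3]
  linear_combination (cayley z : ℂ) * ((cayley z ^ α : ℝ) : ℂ) * powSum (dSeq α lam) (cayley z)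
    * powSum (fun k => vSeq α lam (k + 1)) z * e

theorem wronskian_eq_secular (hα : 0 < α) {z : ℝ} (hz : z ∈ Ioo (0 : ℝ) 1) :
    wronskian α lam z = secular α lam := by
  refine tendsto_nhds_unique ?_ (tendsto_wronskian_zero hα)
  refine (tendsto_congr' ?_).1 (tendsto_const_nhds (x := wronskian α lam z))
  filter_upwards [Ioo_mem_nhdsGT one_pos] with w hw
  exact wronskian_eq hα hz hw

end Wronskian

/-! ### Behaviour of the two solutions at the end point `z = 1` -/

section EndPoint

variable {α : ℝ} {lam : ℂ}

theorem tendsto_one_sub_rpow {β : ℝ} (hβ : 0 < β) :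
    Tendsto (fun z : ℝ => (1 - z) ^ β) (𝓝[<] 1) (𝓝 0) := by
  have h : ContinuousAt (fun z : ℝ => (1 - z) ^ β) 1 :=
    (continuousAt_const.sub continuousAt_id).rpow_const (Or.inr hβ.le)
  have := h.tendsto.mono_left (nhdsWithin_le_nhds (s := Iio 1))
  simpa [Real.zero_rpow hβ.ne'] using this

theorem tendsto_powSum_cayley_one {a : ℕ → ℂ} (ha : PolyBdd a) :
    Tendsto (fun z : ℝ => powSum a (cayley z)) (𝓝[<] 1) (𝓝 (a 0)) := by
  have h := (continuousAt_powSum_ofReal ha (x := 0) (by simp)).tendsto.comp tendsto_cayley_one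
  simpa [powSum_zero, Function.comp_def] using h

theorem norm_cayley_rpow_le (hα : 0 < α) {z : ℝ} (hz : z ∈ Ioo (0 : ℝ) 1) :
    ‖((cayley z ^ α : ℝ) : ℂ)‖ ≤ (1 - z) ^ α := by
  rw [Complex.norm_real, Real.norm_of_nonneg (Real.rpow_nonneg (cayley_pos hz).le _)]
  exact Real.rpow_le_rpow (cayley_pos hz).le (cayley_le hz) hα.le

theorem norm_one_sub_sq_le {z : ℝ} (hz : z ∈ Ioo (0 : ℝ) 1) :
    ‖1 - (z : ℂ) ^ 2‖ ≤ 2 * (1 - z) := by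
  have : 1 - (z : ℂ) ^ 2 = ((1 - z ^ 2 : ℝ) : ℂ) := by push_cast; rfl
  rw [this, Complex.norm_real, Real.norm_of_nonneg (by nlinarith [hz.1, hz.2])]
  nlinarith [hz.1, hz.2]

/-- Cauchy–Schwarz for `∑ (n + 1) v (n + 1) z ^ n`: the squares of the weights `(n + 1) z ^ n` sum
to `O((1 - z) ^ (-3))`. It is carried out termwise, with weight `t = (1 - z) ^ (-3/2)` balancing the
two sums. -/
theorem norm_powSum_uSeq_le (hv : Summable fun n => ‖vSeq α lam n‖ ^ 2) {z : ℝ}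
    (hz : z ∈ Ioo (0 : ℝ) 1) : ‖powSum (fun k => uSeq α lam (k + 1)) z‖
      ≤ ((∑' n, ‖vSeq α lam (n + 1)‖ ^ 2) + 2) * (1 - z) ^ (-(3 / 2) : ℝ) := by
  set s := 1 - z with hs
  have hs0 : 0 < s := by linarith [hz.2]
  set t := s ^ (-(3 / 2) : ℝ) with ht
  have ht0 : 0 < t := Real.rpow_pos_of_pos hs0 _
  have htt : t * t * s ^ 3 = 1 := by
    rw [ht, ← Real.rpow_add hs0, ← Real.rpow_natCast s 3, ← Real.rpow_add hs0]
    norm_num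
  have hz2 : ‖z ^ 2‖ < 1 := by
    rw [Real.norm_of_nonneg (by positivity)]
    nlinarith [hz.1, hz.2]
  have hS := hasSum_choose_mul_geometric_of_norm_lt_one 2 hz2
  have hv1 := (summable_nat_add_iff 1).2 hv
  have hsum := (hv1.hasSum.mul_left t).add (hS.mul_left (2 / t))
  have hterm : ∀ n : ℕ, ‖uSeq α lam (n + 1) * (z : ℂ) ^ n‖ ≤ t * ‖vSeq α lam (n + 1)‖ ^ 2
      + 2 / t * (((n + 2).choose 2 : ℕ) * (z ^ 2) ^ n) := by
    intro n
    have hc : ((n : ℝ) + 1) ^ 2 ≤ 2 * ((n + 2).choose 2 : ℕ) := by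
      have : ((n + 2).choose 2 : ℝ) = ((n : ℝ) + 2) * ((n : ℝ) + 1) / 2 := by
        rw [Nat.cast_choose_two]; push_cast; ring
      rw [this]
      nlinarith [(Nat.cast_nonneg n : (0 : ℝ) ≤ n)]
    have e : ‖uSeq α lam (n + 1) * (z : ℂ) ^ n‖
        = ‖vSeq α lam (n + 1)‖ * (((n : ℝ) + 1) * z ^ n) := by
      rw [← add_one_mul_vSeq, norm_mul, norm_mul, norm_natCast_add_one, norm_pow,
        Complex.norm_real, Real.norm_of_nonneg hz.1.le]
      ring
    rw [e]
    set a := ‖vSeq α lam (n + 1)‖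
    set b := ((n : ℝ) + 1) * z ^ n with hb
    have hb2 : b ^ 2 ≤ 2 * (((n + 2).choose 2 : ℕ) * (z ^ 2) ^ n) := by
      have : b ^ 2 = ((n : ℝ) + 1) ^ 2 * (z ^ 2) ^ n := by rw [hb]; ring
      rw [this, ← mul_assoc]
      gcongr
    have h1 : a * b ≤ t * a ^ 2 + b ^ 2 / t := by
      rw [← sub_nonneg]
      have : t * a ^ 2 + b ^ 2 / t - a * b
          = ((t * a - b / 2) ^ 2 + 3 / 4 * b ^ 2) / t := by field_simp; ring
      rw [this]
      positivity
    calc a * b ≤ t * a ^ 2 + b ^ 2 / t := h1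
      _ ≤ t * a ^ 2 + 2 * (((n + 2).choose 2 : ℕ) * (z ^ 2) ^ n) / t := by gcongr
      _ = _ := by ring
  have h := tsum_of_norm_bounded hsum hterm
  refine h.trans ?_
  have h3 : 1 / (1 - z ^ 2) ^ (2 + 1) ≤ 1 / s ^ 3 := by
    have : s ≤ 1 - z ^ 2 := by nlinarith [hz.1, hz.2]
    gcongr
  calc t * (∑' n, ‖vSeq α lam (n + 1)‖ ^ 2) + 2 / t * (1 / (1 - z ^ 2) ^ (2 + 1))
      ≤ t * (∑' n, ‖vSeq α lam (n + 1)‖ ^ 2) + 2 / t * (1 / s ^ 3) := by gcongr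
    _ = _ := by
      have : 2 / t * (1 / s ^ 3) = 2 * t := by
        field_simp
        linarith
      rw [this]
      ring

theorem norm_powSum_le_of_bound {a : ℕ → ℂ} {M : ℝ} (hM : ∀ n, ‖a n‖ ≤ M) {z : ℝ}
    (hz : z ∈ Ioo (0 : ℝ) 1) : ‖powSum a z‖ ≤ M * (1 - z)⁻¹ := by
  refine tsum_of_norm_bounded ((hasSum_geometric_of_lt_one hz.1.le hz.2).mul_left M) fun n => ?_
  rw [norm_mul, norm_pow, Complex.norm_real, Real.norm_of_nonneg hz.1.le]
  have := hz.1.le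
  gcongr
  exact hM n

/-- If the coefficients are square summable then the secular function vanishes. -/
theorem secular_eq_zero_of_summable (hα : 1 / 2 < α)
    (hv : Summable fun n => ‖vSeq α lam n‖ ^ 2) : secular α lam = 0 := by
  have hα0 : 0 < α := by linarith
  set V := ∑' n, ‖vSeq α lam (n + 1)‖ ^ 2
  have hflux : Tendsto (fluxSum α lam) (𝓝[<] 1) (𝓝 0) := by
    -- The exponent collects `α` from the weight, `1` from `1 - z ^ 2` and `-3/2` from the bound on
    -- `g'`; its positivity is the condition `ε < 2`.
    have h := (tendsto_one_sub_rpow (β := α - 1 / 2) (by linarith)).const_mul (2 * (V + 2))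
    rw [mul_zero] at h
    refine squeeze_zero_norm' ?_ h
    filter_upwards [Ioo_mem_nhdsLT (zero_lt_one' ℝ)] with z hz
    have hs0 : 0 < 1 - z := by linarith [hz.2]
    have h1 := norm_powSum_uSeq_le hv hz
    rw [fluxSum, norm_mul, norm_mul]
    calc _ ≤ (1 - z) ^ α * (2 * (1 - z) * ((V + 2) * (1 - z) ^ (-(3 / 2) : ℝ))) := by
          gcongr
          · exact norm_cayley_rpow_le hα0 hz
          · exact norm_one_sub_sq_le hz
      _ = 2 * (V + 2) * ((1 - z) ^ α * (1 - z) ^ (1 : ℝ) * (1 - z) ^ (-(3 / 2) : ℝ)) := by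
          rw [Real.rpow_one]; ring
      _ = _ := by
          rw [← Real.rpow_add hs0, ← Real.rpow_add hs0]
          congr 2
          ring
  obtain ⟨M, hM⟩ : ∃ M, ∀ n, ‖vSeq α lam n‖ ≤ M := by
    refine ⟨1 + ∑' n, ‖vSeq α lam n‖ ^ 2, fun n => ?_⟩
    have := hv.le_tsum n fun _ _ => by positivity
    nlinarith [sq_nonneg (‖vSeq α lam n‖ - 1)]
  have hM0 : 0 ≤ M := (norm_nonneg _).trans (hM 0)
  have hg : Tendsto (fun z : ℝ => (cayley z : ℂ) * ((cayley z ^ α : ℝ) : ℂ)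
      * powSum (vSeq α lam) z) (𝓝[<] 1) (𝓝 0) := by
    have h := (tendsto_one_sub_rpow hα0).const_mul M
    rw [mul_zero] at h
    refine squeeze_zero_norm' ?_ h
    filter_upwards [Ioo_mem_nhdsLT (zero_lt_one' ℝ)] with z hz
    have hs0 : 0 < 1 - z := by linarith [hz.2]
    rw [norm_mul, norm_mul, Complex.norm_real (cayley z), Real.norm_of_nonneg (cayley_pos hz).le]
    calc _ ≤ (1 - z) * (1 - z) ^ α * (M * (1 - z)⁻¹) := by
          gcongr
          · exact cayley_le hz
          · exact norm_cayley_rpow_le hα0 hz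
          · exact norm_powSum_le_of_bound hM hz
      _ = _ := by field_simp
  have hf := tendsto_powSum_cayley_one (polyBdd_cSeq (lam := lam) hα0)
  have hd := tendsto_powSum_cayley_one (polyBdd_dSeq (lam := lam) hα0)
  have hW := (hf.mul hflux).add ((hd.mul hg).const_mul 2)
  simp only [mul_zero, add_zero] at hW
  refine tendsto_nhds_unique ?_ hW
  refine (tendsto_congr' ?_).1 (tendsto_const_nhds (x := secular α lam))
  filter_upwards [Ioo_mem_nhdsLT (zero_lt_one' ℝ)] with z hz
  rw [← wronskian_eq_secular hα0 hz, wronskian]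
  ring

/-- At a zero of the secular function the eigenfunction is regular at the end point. -/
theorem exists_bound_of_secular_eq_zero (hα : 0 < α) (h0 : secular α lam = 0) :
    ∃ M : ℝ, ∀ᶠ z : ℝ in 𝓝[<] 1, ‖powSum (vSeq α lam) z‖ ≤ M ∧
      ‖powSum (fun k => uSeq α lam (k + 1)) z‖ ≤ M := by
  have hf := tendsto_powSum_cayley_one (polyBdd_cSeq (lam := lam) hα)
  have hd := tendsto_powSum_cayley_one (polyBdd_dSeq (lam := lam) hα)
  have hc0 : cSeq α lam 0 = 1 := by simp [cSeq]
  rw [hc0] at hf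
  have hev : ∀ᶠ z : ℝ in 𝓝[<] 1, powSum (cSeq α lam) (cayley z) ≠ 0 ∧
      ‖powSum (cSeq α lam) (cayley z)‖ ≤ 2 ∧
      ‖powSum (dSeq α lam) (cayley z)‖ ≤ ‖dSeq α lam 0‖ + 1 := by
    have e2 := hf.norm.eventually_le_const (u := 2) (by norm_num)
    have e3 := hd.norm.eventually_le_const (u := ‖dSeq α lam 0‖ + 1) (by linarith)
    filter_upwards [hf.eventually_ne one_ne_zero, e2, e3] with z h1 h2 h3 using ⟨h1, h2, h3⟩
  -- Since `f` equals `1` at `x = 0`, there is an interval `(l, 1)` on which `f` does not vanish and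
  -- the quotient `g / f` makes sense.
  obtain ⟨l, hl, hsub⟩ := (mem_nhdsLT_iff_exists_Ioo_subset' (zero_lt_one' ℝ)).1
    (inter_mem hev (Ioo_mem_nhdsLT (zero_lt_one' ℝ)))
  rw [mem_Iio] at hl
  -- The vanishing Wronskian divided by `p`, that is `g' f = g f'`; hence `g / f` is constant on
  -- `(l, 1)`.
  have hW : ∀ z ∈ Ioo (0 : ℝ) 1, powSum (fun k => uSeq α lam (k + 1)) z
      * powSum (cSeq α lam) (cayley z) = powSum (vSeq α lam) z
      * (powSum (dSeq α lam) (cayley z) * (-2 / (1 + z) ^ 2)) := by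
    intro z hz
    have h := wronskian_eq_secular (lam := lam) hα hz
    rw [h0, wronskian, fluxSum] at h
    have hr : ((cayley z ^ α : ℝ) : ℂ) ≠ 0 :=
      Complex.ofReal_ne_zero.2 (Real.rpow_pos_of_pos (cayley_pos hz) _).ne'
    have e7 : (2 / (1 + (z : ℂ)) ^ 2) * (1 - z ^ 2) = 2 * (cayley z : ℂ) := by
      have h1 := one_add_ne hz
      have : 1 - (z : ℂ) ^ 2 = (1 - z) * (1 + z) := by ring
      rw [this, cayley_ofReal]; field_simp
    have h2 := one_sub_sq_ne hz
    refine mul_left_cancel₀ (mul_ne_zero hr h2) ?_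
    linear_combination h + ((cayley z ^ α : ℝ) : ℂ) * powSum (dSeq α lam) (cayley z)
      * powSum (vSeq α lam) z * e7
  have hderiv : ∀ z ∈ Ioo l 1, HasDerivAt
      (fun t : ℝ => powSum (vSeq α lam) t / powSum (cSeq α lam) (cayley t)) 0 z := by
    intro z hz
    obtain ⟨⟨hne, -, -⟩, hz'⟩ := hsub hz
    have h1 := hasDerivAt_powSum_vSeq (lam := lam) hα (abs_lt_one_of_mem hz')
    have h2 := hasDerivAt_powSum_cSeq_cayley (lam := lam) hα hz'
    refine (h1.div h2 hne).congr_deriv ?_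
    rw [hW z hz', sub_self, zero_div]
  set m := (l + 1) / 2
  have hm : m ∈ Ioo l 1 := ⟨by simp only [m]; linarith [hl], by simp only [m]; linarith [hl]⟩
  set C := powSum (vSeq α lam) m / powSum (cSeq α lam) (cayley m)
  have hgC : ∀ z ∈ Ioo l 1, powSum (vSeq α lam) z = C * powSum (cSeq α lam) (cayley z) := by
    intro z hz
    have := isOpen_Ioo.is_const_of_deriv_eq_zero isPreconnected_Ioo
      (fun t ht => (hderiv t ht).differentiableAt.differentiableWithinAt)
      (fun t ht => (hderiv t ht).deriv) hz hm
    rw [div_eq_iff (hsub hz).1.1] at this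
    exact this
  refine ⟨‖C‖ * 2 * (‖dSeq α lam 0‖ + 1), ?_⟩
  filter_upwards [Ioo_mem_nhdsLT hl] with z hz
  obtain ⟨⟨hne, hb2, hb3⟩, hz'⟩ := hsub hz
  have hG : powSum (fun k => uSeq α lam (k + 1)) z
      = C * (powSum (dSeq α lam) (cayley z) * (-2 / (1 + z) ^ 2)) := by
    refine mul_right_cancel₀ hne ?_
    rw [hW z hz', hgC z hz]
    ring
  constructor
  · rw [hgC z hz, norm_mul]
    calc ‖C‖ * ‖powSum (cSeq α lam) (cayley z)‖ ≤ ‖C‖ * 2 * 1 := by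
          rw [mul_one]; gcongr
      _ ≤ _ := by gcongr; linarith [norm_nonneg (dSeq α lam 0)]
  · have h2 : ‖(-2 / (1 + (z : ℂ)) ^ 2)‖ ≤ 2 := by
      have : (-2 / (1 + (z : ℂ)) ^ 2) = ((-(2 / (1 + z) ^ 2) : ℝ) : ℂ) := by push_cast; ring
      rw [this, Complex.norm_real, norm_neg, Real.norm_of_nonneg (by positivity)]
      exact div_le_self zero_le_two (by nlinarith [hz'.1])
    rw [hG, norm_mul, norm_mul]
    calc _ ≤ ‖C‖ * ((‖dSeq α lam 0‖ + 1) * 2) := by gcongr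
      _ = _ := by ring

end EndPoint

/-! ### Zeros of the secular function are real and give decaying coefficients -/

section Reality

variable {α : ℝ} {lam : ℂ}

/-- Lagrange identity: the derivative of `Im lam * Im (p g' conj g)` is `-2 α (Im lam) ^ 2 r |g| ^ 2
/ z`, which has a sign. The function itself tends to `0` at both ends, at `0` because `g` vanishes
and at `1` because `g`, `g'` are bounded while `p` tends to `0`. So it is constant, and `Im lam = 0`
as `g` is not identically zero. -/
theorem im_eq_zero_of_secular_eq_zero (hα : 0 < α) (h0 : secular α lam = 0) : lam.im = 0 := by
  obtain ⟨M, hM⟩ := exists_bound_of_secular_eq_zero hα h0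
  set V : ℝ → ℂ := fun z => powSum (fun k => vSeq α lam (k + 1)) z with hV
  set Q : ℝ → ℝ := fun z => lam.im *
    (fluxSum α lam z * (starRingEnd ℂ) (powSum (vSeq α lam) z)).im with hQ
  have hQd : ∀ z ∈ Ioo (0 : ℝ) 1, HasDerivAt Q
      (-(2 * α * lam.im ^ 2 * cayley z ^ α * z * ‖V z‖ ^ 2)) z := by
    intro z hz
    have h1 := hasDerivAt_fluxSum (lam := lam) hα hz
    have h2 := (hasDerivAt_powSum_vSeq (lam := lam) hα (abs_lt_one_of_mem hz)).star
    have h3 := Complex.imCLM.hasFDerivAt.comp_hasDerivAt z (h1.mul h2)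
    refine (h3.const_mul lam.im).congr_deriv ?_
    rw [powSum_vSeq hα (abs_lt_one_of_mem hz)]
    change lam.im * (-2 * α * lam * ((cayley z ^ α : ℝ) : ℂ) * V z * (starRingEnd ℂ) (z * V z)
      + ((cayley z ^ α : ℝ) : ℂ) * ((1 - (z : ℂ) ^ 2) * powSum (fun k => uSeq α lam (k + 1)) z)
        * (starRingEnd ℂ) (powSum (fun k => uSeq α lam (k + 1)) z)).im = _
    generalize powSum (fun k => uSeq α lam (k + 1)) (z : ℂ) = U
    have e1 : -2 * α * lam * ((cayley z ^ α : ℝ) : ℂ) * V z * (starRingEnd ℂ) (z * V z)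
        = ((-2 * α * cayley z ^ α * z * ‖V z‖ ^ 2 : ℝ) : ℂ) * lam := by
      rw [map_mul, Complex.conj_ofReal]
      push_cast
      rw [← Complex.mul_conj']
      ring
    have e2 : ((cayley z ^ α : ℝ) : ℂ) * ((1 - (z : ℂ) ^ 2) * U) * (starRingEnd ℂ) U
        = ((cayley z ^ α * (1 - z ^ 2) * ‖U‖ ^ 2 : ℝ) : ℂ) := by
      push_cast
      rw [← Complex.mul_conj']
      ring
    rw [e1, e2, Complex.add_im, Complex.ofReal_im, Complex.im_ofReal_mul]
    ring
  have hanti : AntitoneOn Q (Ioo 0 1) := by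
    refine antitoneOn_of_deriv_nonpos (convex_Ioo 0 1)
      (fun z hz => (hQd z hz).continuousAt.continuousWithinAt) ?_ ?_
    · rw [interior_Ioo]
      exact fun z hz => (hQd z hz).differentiableAt.differentiableWithinAt
    · rw [interior_Ioo]
      intro z hz
      rw [(hQd z hz).deriv, neg_nonpos]
      have := Real.rpow_nonneg (cayley_pos hz).le α
      have := hz.1.le
      positivity
  have hVc : ContinuousAt V 0 :=
    continuousAt_powSum_ofReal (polyBdd_vSeq (lam := lam) hα).shift (by simp)
  have hlim0 : Tendsto Q (𝓝[>] 0) (𝓝 0) := by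
    have hx0 : cayley 0 = 1 := by simp [cayley]
    have hc : ContinuousAt cayley 0 := (hasDerivAt_cayley (z := 0) (by norm_num)).continuousAt
    have hr : ContinuousAt (fun z => ((cayley z ^ α : ℝ) : ℂ)) 0 :=
      Complex.continuous_ofReal.continuousAt.comp
        (hc.rpow_const (Or.inl (by rw [hx0]; norm_num)))
    have hU := continuousAt_powSum_ofReal (polyBdd_uSeq (lam := lam) hα).shift
      (x := 0) (by simp)
    have hg := continuousAt_powSum_ofReal (polyBdd_vSeq (lam := lam) hα) (x := 0) (by simp)
    have hz : ContinuousAt (fun z : ℝ => (z : ℂ)) 0 := Complex.continuous_ofReal.continuousAt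
    have h : ContinuousAt Q 0 := continuousAt_const.mul
      (Complex.continuous_im.continuousAt.comp ((hr.mul ((continuousAt_const.sub (hz.pow 2)).mul
        hU)).mul (Complex.continuous_conj.continuousAt.comp hg)))
    have hQ0 : Q 0 = 0 := by simp [hQ, powSum_zero, vSeq_zero]
    have := h.tendsto.mono_left (nhdsWithin_le_nhds (s := Ioi 0))
    rwa [hQ0] at this
  have hlim1 : Tendsto Q (𝓝[<] 1) (𝓝 0) := by
    have h := (tendsto_one_sub_rpow hα).const_mul (|lam.im| * 2 * M ^ 2)
    rw [mul_zero] at h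
    refine squeeze_zero_norm' ?_ h
    filter_upwards [Ioo_mem_nhdsLT (zero_lt_one' ℝ), hM] with z hz hMz
    have hs0 : 0 < 1 - z := by linarith [hz.2]
    have hM0 : 0 ≤ M := (norm_nonneg _).trans hMz.1
    have h1 := norm_one_sub_sq_le hz
    rw [hQ, norm_mul, Real.norm_eq_abs]
    calc |lam.im| * ‖(fluxSum α lam z * (starRingEnd ℂ) (powSum (vSeq α lam) z)).im‖
        ≤ |lam.im| * ‖fluxSum α lam z * (starRingEnd ℂ) (powSum (vSeq α lam) z)‖ := by
          gcongr
          exact Complex.abs_im_le_norm _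
      _ ≤ |lam.im| * ((1 - z) ^ α * (2 * M) * M) := by
          rw [norm_mul, fluxSum, norm_mul, norm_mul, RCLike.norm_conj]
          gcongr
          · exact norm_cayley_rpow_le hα hz
          · linarith [hz.1]
          · exact hMz.2
          · exact hMz.1
      _ = _ := by ring
  have hzero : ∀ z ∈ Ioo (0 : ℝ) 1, Q z = 0 := by
    intro z hz
    refine le_antisymm (ge_of_tendsto hlim0 ?_) (le_of_tendsto hlim1 ?_)
    · filter_upwards [Ioo_mem_nhdsGT hz.1] with w hw
      exact hanti ⟨hw.1, hw.2.trans hz.2⟩ hz hw.2.le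
    · filter_upwards [Ioo_mem_nhdsLT hz.2] with w hw
      exact hanti hz ⟨hz.1.trans hw.1, hw.2⟩ hw.1.le
  have hV0 : V 0 = 1 := by simp [hV, powSum_zero, vSeq_one]
  have hne : ∀ᶠ z in 𝓝[>] (0 : ℝ), V z ≠ 0 :=
    (hVc.tendsto.mono_left nhdsWithin_le_nhds).eventually_ne (by rw [hV0]; exact one_ne_zero)
  obtain ⟨z, hVz, hz⟩ := (hne.and (Ioo_mem_nhdsGT one_pos)).exists
  have hd := hQd z hz
  have hd0 : HasDerivAt Q 0 z := by
    refine (hasDerivAt_const z 0).congr_of_eventuallyEq ?_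
    filter_upwards [isOpen_Ioo.mem_nhds hz] with w hw using hzero w hw
  have he := hd.unique hd0
  have hr := Real.rpow_pos_of_pos (cayley_pos hz) α
  have hp : 0 < 2 * α * cayley z ^ α * z * ‖V z‖ ^ 2 := by
    have := hz.1
    have := norm_pos_iff.2 hVz
    positivity
  have : lam.im ^ 2 * (2 * α * cayley z ^ α * z * ‖V z‖ ^ 2) = 0 := by linarith
  rcases mul_eq_zero.1 this with h | h
  · exact pow_eq_zero_iff two_ne_zero |>.1 h
  · exact absurd h hp.ne'

/-- A real positive-tail lower bound makes the power series blow up at the end point. -/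
theorem not_bounded_of_tail_ge {a : ℕ → ℂ} (ha : PolyBdd a) {δ : ℝ} (hδ : 0 < δ) {m : ℕ}
    (h : ∀ n, m ≤ n → δ ≤ (a n).re) (M : ℝ) : ¬ ∀ᶠ z : ℝ in 𝓝[<] 1, ‖powSum a z‖ ≤ M := by
  intro hM
  -- `C` pays for the first `m` terms, so the real part of the sum is at least `δ / (1 - z) - C`,
  -- which tends to infinity.
  set C := ∑ n ∈ Finset.range m, (δ + ‖a n‖)
  have hlow : ∀ z ∈ Ioo (0 : ℝ) 1, δ * (1 - z)⁻¹ - C ≤ ‖powSum a z‖ := by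
    intro z hz
    have hs := ha.summable (z := z) (by simpa using abs_lt_one_of_mem hz)
    have h1 : HasSum (fun n => (a n * (z : ℂ) ^ n).re) (powSum a z).re :=
      Complex.hasSum_re hs.hasSum
    have h2 : HasSum (fun n => if n ∈ Finset.range m then (δ + ‖a n‖) else 0) C := by
      have := hasSum_sum_of_ne_finset_zero (L := .unconditional ℕ) (s := Finset.range m)
        (f := fun n => if n ∈ Finset.range m then (δ + ‖a n‖) else 0)
        (fun n hn => if_neg hn)
      rwa [Finset.sum_ite_mem, Finset.inter_self] at this
    have h3 := (hasSum_geometric_of_lt_one hz.1.le hz.2).mul_left δ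
    have h4 := hasSum_le (fun n => ?_) h3 (h1.add h2)
    · linarith [Complex.re_le_norm (powSum a z)]
    · have hz0 : 0 ≤ z ^ n := pow_nonneg hz.1.le n
      have hz1 : z ^ n ≤ 1 := pow_le_one₀ hz.1.le hz.2.le
      have e : (a n * (z : ℂ) ^ n).re = (a n).re * z ^ n := by
        rw [← Complex.ofReal_pow, Complex.re_mul_ofReal]
      rw [e]
      by_cases hn : n < m
      · rw [if_pos (Finset.mem_range.2 hn)]
        have h5 := neg_le_of_abs_le (Complex.abs_re_le_norm (a n))
        have h6 := norm_nonneg (a n)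
        nlinarith
      · rw [if_neg (by simpa using hn), add_zero]
        exact mul_le_mul_of_nonneg_right (h n (not_lt.1 hn)) hz0
  have hlim : Tendsto (fun z : ℝ => δ * (1 - z)⁻¹ - C) (𝓝[<] 1) atTop := by
    have h1 : Tendsto (fun z : ℝ => 1 - z) (𝓝[<] 1) (𝓝[>] 0) := by
      refine tendsto_nhdsWithin_iff.2 ⟨?_, ?_⟩
      · have : ContinuousAt (fun z : ℝ => 1 - z) 1 := by fun_prop
        simpa using this.tendsto.mono_left (nhdsWithin_le_nhds (s := Iio 1))
      · filter_upwards [self_mem_nhdsWithin] with z hz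
        simpa using hz
    exact tendsto_atTop_add_const_right _ _
      ((tendsto_inv_nhdsGT_zero.comp h1).const_mul_atTop hδ)
  obtain ⟨z, ⟨h1, h2⟩, hz⟩ := ((hM.and (hlim.eventually_gt_atTop M)).and
    (Ioo_mem_nhdsLT (zero_lt_one' ℝ))).exists
  linarith [hlow z hz]

/-- Two consecutive terms of equal sign of a solution to a three-term recurrence with positive
coefficients force a positive lower bound. -/
theorem exists_lower_bound {y t : ℕ → ℝ} {N : ℕ} (ht : ∀ n, N ≤ n → 0 < t n)
    (hy : ∀ n, y (n + 2) = y n + t n * y (n + 1)) (h0 : 0 ≤ y N) (h1 : 0 ≤ y (N + 1))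
    (hne : ¬ (y N = 0 ∧ y (N + 1) = 0)) : ∃ δ, 0 < δ ∧ ∀ n, N + 2 ≤ n → δ ≤ y n := by
  have hcase : 0 < y N ∨ 0 < y (N + 1) := by
    by_contra! hc
    exact hne ⟨le_antisymm hc.1 h0, le_antisymm hc.2 h1⟩
  have p2 : 0 < y (N + 2) := by
    rw [hy]
    have := ht N le_rfl
    rcases hcase with h | h
    · have := mul_nonneg this.le h1
      linarith
    · have := mul_pos this h
      linarith
  have p3 : 0 < y (N + 3) := by
    rw [hy (N + 1)]
    have := mul_pos (ht (N + 1) (by omega)) p2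
    have e : N + 1 + 1 = N + 2 := rfl
    rw [e]
    linarith
  set δ := min (y (N + 2)) (y (N + 3))
  have hδ : 0 < δ := lt_min p2 p3
  have key : ∀ k, δ ≤ y (N + 2 + k) ∧ δ ≤ y (N + 2 + k + 1) := by
    intro k
    induction k with
    | zero => exact ⟨min_le_left _ _, min_le_right _ _⟩
    | succ k ih =>
      refine ⟨ih.2, ?_⟩
      have := hy (N + 2 + k)
      have h2 := mul_pos (ht (N + 2 + k) (by omega)) (hδ.trans_le ih.2)
      have e : N + 2 + (k + 1) + 1 = N + 2 + k + 2 := by ring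
      rw [e, this]
      linarith [ih.1]
  refine ⟨δ, hδ, fun n hn => ?_⟩
  obtain ⟨k, rfl⟩ := Nat.exists_eq_add_of_le hn
  exact (key k).1

theorem exists_real_uSeq (l : ℝ) : ∃ w : ℕ → ℝ, (∀ n, uSeq α l n = w n) ∧ w 0 = 0 ∧ w 1 = 1 ∧
    ∀ n : ℕ, w (n + 2) = w n + 2 * α / (n + 1) * (1 - l / (n + 1)) * w (n + 1) := by
  have him : ∀ n, (uSeq α l n).im = 0 ∧ (uSeq α l (n + 1)).im = 0 := by
    intro n
    induction n with
    | zero => simp [uSeq, threeTerm]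
    | succ n ih =>
      refine ⟨ih.2, ?_⟩
      have : (2 * (α : ℂ) / (n + 1) * (1 - l / (n + 1)))
          = ((2 * α / (n + 1) * (1 - l / (n + 1)) : ℝ) : ℂ) := by push_cast; rfl
      rw [uSeq_succ_succ, this, Complex.add_im, Complex.im_ofReal_mul, ih.1, ih.2]
      simp
  have hw : ∀ n, uSeq α l n = ((uSeq α l n).re : ℂ) := fun n =>
    Complex.ext rfl (by rw [Complex.ofReal_im]; exact (him n).1)
  refine ⟨fun n => (uSeq α l n).re, hw, by simp [uSeq, threeTerm], by simp [uSeq, threeTerm],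
    fun n => ?_⟩
  have : (2 * (α : ℂ) / (n + 1) * (1 - l / (n + 1)))
      = ((2 * α / (n + 1) * (1 - l / (n + 1)) : ℝ) : ℂ) := by push_cast; rfl
  dsimp only
  rw [uSeq_succ_succ, this, Complex.add_re, Complex.re_ofReal_mul]

/-- At a zero of the secular function the derivative of the eigenfunction is square summable. -/
theorem summable_uSeq_of_secular_eq_zero (hα : 1 / 2 < α) (h0 : secular α lam = 0) :
    Summable fun n => ‖uSeq α lam n‖ ^ 2 := by
  have hα0 : 0 < α := by linarith
  obtain ⟨l, rfl⟩ : ∃ l : ℝ, lam = l :=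
    ⟨lam.re, Complex.ext rfl (by simpa using im_eq_zero_of_secular_eq_zero hα0 h0)⟩
  obtain ⟨M, hM⟩ := exists_bound_of_secular_eq_zero hα0 h0
  obtain ⟨w, hw, hw0, hw1, hwr⟩ := exists_real_uSeq (α := α) l
  have hne : ∀ n, ¬ (w n = 0 ∧ w (n + 1) = 0) := by
    intro n
    induction n with
    | zero => rintro ⟨-, h⟩; rw [hw1] at h; exact one_ne_zero h
    | succ n ih =>
      rintro ⟨h1, h2⟩
      have := hwr n
      rw [h1, h2, mul_zero, add_zero] at this
      exact ih ⟨this.symm, h1⟩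
  have hpu := (polyBdd_uSeq (lam := l) hα0).shift
  -- Beyond `l` the coefficients of the recurrence are positive; beyond the second number the term
  -- `2 α l / (n + 1)` uses up at most half of the margin `2 α - 1`.
  obtain ⟨N, hN⟩ := exists_nat_gt (max l (2 * α * l / (α - 1 / 2)))
  have ht : ∀ n : ℕ, N ≤ n → 0 < 2 * α / ((n : ℝ) + 1) * (1 - l / (n + 1)) := by
    intro n hn
    have hn' : (N : ℝ) ≤ n := by exact_mod_cast hn
    have hl : l < (n : ℝ) + 1 := by linarith [le_max_left l (2 * α * l / (α - 1 / 2))]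
    have : l / ((n : ℝ) + 1) < 1 := (div_lt_one (by positivity)).2 hl
    have : 0 < 1 - l / ((n : ℝ) + 1) := by linarith
    positivity
  -- Two neighbours of weakly equal sign would keep the tail of `σ w` above a positive constant, so
  -- `g'` would blow up at `z = 1`, against its boundedness. Hence signs eventually alternate
  -- strictly.
  have halt : ∀ n, N ≤ n → w n * w (n + 1) < 0 := by
    intro n hn
    by_contra! hc
    have hσ : ∃ σ : ℝ, σ ^ 2 = 1 ∧ 0 ≤ σ * w n ∧ 0 ≤ σ * w (n + 1) := by
      rcases mul_nonneg_iff.1 hc with h | h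
      · exact ⟨1, by norm_num, by linarith [h.1], by linarith [h.2]⟩
      · exact ⟨-1, by norm_num, by linarith [h.1], by linarith [h.2]⟩
    obtain ⟨σ, hσ1, h1, h2⟩ := hσ
    have hσ0 : σ ≠ 0 := by rintro rfl; norm_num at hσ1
    obtain ⟨δ, hδ, hb⟩ := exists_lower_bound (y := fun k => σ * w k) (N := n)
      (fun k hk => ht k (hn.trans hk)) (fun k => by rw [hwr]; ring) h1 h2
      (fun h => hne n (by simpa [hσ0] using h))
    refine not_bounded_of_tail_ge (hpu.const_mul σ) hδ (m := n + 2) (fun k hk => ?_) M ?_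
    · rw [hw, ← Complex.ofReal_mul, Complex.ofReal_re]
      exact hb (k + 1) (by omega)
    · filter_upwards [hM] with z hz
      have hσn : ‖(σ : ℂ)‖ = 1 := by
        rw [Complex.norm_real, Real.norm_eq_abs, ← pow_eq_one_iff_of_nonneg (abs_nonneg σ) two_ne_zero,
          sq_abs, hσ1]
      rw [powSum_const_mul, norm_mul, hσn, one_mul]
      exact hz.2
  have hη : 0 < α - 1 / 2 := by linarith
  -- A discrete energy. Alternation makes it nonnegative, and the recurrence gives `T n - T (n + 1)
  -- = (w n + w (n + 1)) ^ 2 / 2 + (2 α - 1 - 2 α l / (n + 1)) w (n + 1) ^ 2`, so its total decrease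
  -- controls `∑ w n ^ 2`.
  set T : ℕ → ℝ := fun n => -(n * (w n * w (n + 1))) + w n ^ 2 / 2 with hT
  have hT0 : ∀ n, N ≤ n → 0 ≤ T n := by
    intro n hn
    have := mul_nonneg (Nat.cast_nonneg n : (0 : ℝ) ≤ n) (neg_pos.2 (halt n hn)).le
    simp only [hT]
    nlinarith [sq_nonneg (w n)]
  have hstep : ∀ n, N ≤ n → (α - 1 / 2) * w (n + 1) ^ 2 ≤ T n - T (n + 1) := by
    intro n hn
    have hn' : (N : ℝ) ≤ n := by exact_mod_cast hn
    have hn1 : (0 : ℝ) < (n : ℝ) + 1 := by positivity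
    have hl : 2 * α * l / ((n : ℝ) + 1) ≤ α - 1 / 2 := by
      rw [div_le_iff₀ hn1, mul_comm (α - 1 / 2), ← div_le_iff₀ hη]
      linarith [le_max_right l (2 * α * l / (α - 1 / 2))]
    have e : ((n : ℝ) + 1) * w (n + 2)
        = ((n : ℝ) + 1) * w n + (2 * α - 2 * α * l / (n + 1)) * w (n + 1) := by
      rw [hwr]; field_simp
    have e2 : T n - T (n + 1) = (w (n + 1)) * (((n : ℝ) + 1) * w (n + 2)) - n * (w n * w (n + 1))
        + w n ^ 2 / 2 - w (n + 1) ^ 2 / 2 := by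
      simp only [hT]; push_cast; ring
    rw [e2, e]
    nlinarith [sq_nonneg (w n + w (n + 1)), mul_le_mul_of_nonneg_right hl (sq_nonneg (w (n + 1)))]
  have hsum : Summable fun k => w (k + (N + 1)) ^ 2 := by
    refine summable_of_sum_range_le (c := T N / (α - 1 / 2)) (fun _ => sq_nonneg _) fun k => ?_
    rw [le_div_iff₀ hη, mul_comm]
    have : (α - 1 / 2) * ∑ i ∈ Finset.range k, w (i + (N + 1)) ^ 2 ≤ T N - T (N + k) := by
      induction k with
      | zero => simp
      | succ k ih =>
        rw [Finset.sum_range_succ, mul_add]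
        have := hstep (N + k) (by omega)
        have e : k + (N + 1) = N + k + 1 := by ring
        rw [e]
        have e' : N + (k + 1) = N + k + 1 := rfl
        rw [e']
        linarith
    linarith [hT0 (N + k) (by omega)]
  refine (summable_nat_add_iff (N + 1)).1 (hsum.congr fun k => ?_)
  rw [hw, Complex.norm_real, Real.norm_eq_abs, sq_abs]

theorem re_pos_of_secular_eq_zero (hα : 0 < α) (h0 : secular α lam = 0) : 0 < lam.re := by
  by_contra! hc
  have h := one_le_secular_neg_re hα (s := -lam.re) (by linarith)
  have e : -((-lam.re : ℝ) : ℂ) = lam := Complex.ext (by simp)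
    (by simp [im_eq_zero_of_secular_eq_zero hα h0])
  rw [e, h0] at h
  simp at h
  linarith

end Reality

/-! ### The Fourier basis -/

/-- The exponential `θ ↦ exp (i n θ)` as a periodic smooth function. -/
noncomputable def expPer (n : ℤ) : C2per :=
  ⟨fun θ => Complex.exp (Complex.I * n * θ), by
    constructor
    · exact ((contDiff_const.mul Complex.ofRealCLM.contDiff).cexp)
    · intro θ
      have : Complex.I * n * ((θ + 2 * Real.pi : ℝ) : ℂ)
          = Complex.I * n * θ + n * (2 * Real.pi * Complex.I) := by push_cast; ring
      simp only [this]
      rw [Complex.exp_add, Complex.exp_int_mul_two_pi_mul_I, mul_one]⟩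

/-- The unnormalized Fourier coefficient. -/
noncomputable def fourierInt (n : ℤ) (f : ℝ → ℂ) : ℂ :=
  ∫ θ in (-Real.pi)..Real.pi, Complex.exp (-(Complex.I * n * θ)) * f θ

theorem neg_pi_lt_pi : -Real.pi < Real.pi := by linarith [Real.pi_pos]

theorem restrict_Ioc_pi : (volume : Measure ℝ).restrict (Ioc (-Real.pi) Real.pi)
    = (volume : Measure ℝ).restrict (Ioo (-Real.pi) Real.pi) :=
  Measure.restrict_congr_set Ioo_ae_eq_Ioc.symm

theorem inner_expPer (n : ℤ) (f : L2) : inner ℂ (toL2 (expPer n)) f = fourierInt n f := by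
  rw [L2.inner_def, fourierInt, intervalIntegral.integral_of_le neg_pi_lt_pi.le,
    restrict_Ioc_pi]
  refine integral_congr_ae ?_
  have h : ⇑(toL2 (expPer n))
      =ᵐ[(volume : Measure ℝ).restrict (Ioo (-Real.pi) Real.pi)] (expPer n).1 :=
    MemLp.coeFn_toLp (memLp_of_continuous (expPer n).2.1.continuous)
  filter_upwards [h] with θ hθ
  rw [hθ, RCLike.inner_apply', expPer, ← Complex.exp_conj]
  simp

theorem fourierInt_congr_ae {f g : ℝ → ℂ}
    (h : f =ᵐ[(volume : Measure ℝ).restrict (Ioo (-Real.pi) Real.pi)] g) (n : ℤ) :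
    fourierInt n f = fourierInt n g := by
  rw [fourierInt, fourierInt, intervalIntegral.integral_of_le neg_pi_lt_pi.le,
    intervalIntegral.integral_of_le neg_pi_lt_pi.le, restrict_Ioc_pi]
  refine integral_congr_ae ?_
  filter_upwards [h] with θ hθ
  rw [hθ]

theorem fourierCoeffOn_eq_fourierInt (n : ℤ) (f : ℝ → ℂ) :
    fourierCoeffOn neg_pi_lt_pi f n = (2 * Real.pi : ℂ)⁻¹ * fourierInt n f := by
  rw [fourierCoeffOn_eq_integral, fourierInt, Complex.real_smul]
  congr 1
  · push_cast; rw [one_div]; congr 1; ring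
  · refine intervalIntegral.integral_congr fun θ _ => ?_
    simp only [fourier_coe_apply, smul_eq_mul]
    congr 2
    have : (Real.pi : ℂ) ≠ 0 := Complex.ofReal_ne_zero.2 Real.pi_ne_zero
    push_cast
    field_simp
    ring

theorem fourierInt_exp (m n : ℤ) : fourierInt m (expPer n).1 = if m = n then
    (2 * Real.pi : ℂ) else 0 := by
  have e : ∀ θ : ℝ, Complex.exp (-(Complex.I * m * θ)) * (expPer n).1 θ
      = Complex.exp ((Complex.I * ((n : ℂ) - m)) * θ) := by
    intro θ
    rw [expPer, ← Complex.exp_add]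
    congr 1
    ring
  simp only [fourierInt, e]
  split_ifs with h
  · subst h
    simp
    ring
  · have hne : Complex.I * ((n : ℂ) - m) ≠ 0 :=
      mul_ne_zero Complex.I_ne_zero (sub_ne_zero.2 (by exact_mod_cast (Ne.symm h)))
    rw [integral_exp_mul_complex hne]
    have : Complex.exp (Complex.I * ((n : ℂ) - m) * (Real.pi : ℝ))
        = Complex.exp (Complex.I * ((n : ℂ) - m) * ((-Real.pi : ℝ) : ℂ)) := by
      rw [Complex.exp_eq_exp_iff_exists_int]
      exact ⟨n - m, by push_cast; ring⟩
    rw [this, sub_self, zero_div]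

/-- The normalized exponentials. -/
noncomputable def expL2 (n : ℤ) : L2 := ((Real.sqrt (2 * Real.pi) : ℝ) : ℂ)⁻¹ • toL2 (expPer n)

theorem inner_expL2 (n : ℤ) (f : L2) :
    inner ℂ (expL2 n) f = ((Real.sqrt (2 * Real.pi) : ℝ) : ℂ)⁻¹ * fourierInt n f := by
  rw [expL2, inner_smul_left, inner_expPer, map_inv₀, Complex.conj_ofReal]

theorem inner_expL2_toLp (n : ℤ) {f : ℝ → ℂ} (hf : Continuous f) :
    inner ℂ (expL2 n) ((memLp_of_continuous hf).toLp f)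
      = ((Real.sqrt (2 * Real.pi) : ℝ) : ℂ)⁻¹ * fourierInt n f := by
  rw [inner_expL2, fourierInt_congr_ae (MemLp.coeFn_toLp _)]

theorem orthonormal_expL2 : Orthonormal ℂ expL2 := by
  rw [orthonormal_iff_ite]
  intro m n
  have h := inner_expL2_toLp m (expPer n).2.1.continuous
  have e : inner ℂ (expL2 m) (expL2 n) = ((Real.sqrt (2 * Real.pi) : ℝ) : ℂ)⁻¹ *
      inner ℂ (expL2 m) ((memLp_of_continuous (expPer n).2.1.continuous).toLp (expPer n).1) := by
    rw [← inner_smul_right]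
    rfl
  rw [e, h, fourierInt_exp]
  have h2 : ((Real.sqrt (2 * Real.pi) : ℝ) : ℂ) * ((Real.sqrt (2 * Real.pi) : ℝ) : ℂ)
      = 2 * Real.pi := by
    rw [← Complex.ofReal_mul, Real.mul_self_sqrt (by positivity)]
    push_cast
    rfl
  split_ifs with hmn
  · have h3 : ((Real.sqrt (2 * Real.pi) : ℝ) : ℂ) ≠ 0 :=
      Complex.ofReal_ne_zero.2 (by positivity)
    rw [← h2]
    field_simp
  · simp

/-- Completeness of the exponentials, read off from Parseval's identity for Fourier coefficients on
an interval. -/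
theorem eq_zero_of_inner_expL2 {f : L2} (h : ∀ n, inner ℂ (expL2 n) f = 0) : f = 0 := by
  have hpi : ((Real.sqrt (2 * Real.pi) : ℝ) : ℂ)⁻¹ ≠ 0 :=
    inv_ne_zero (Complex.ofReal_ne_zero.2 (by positivity))
  have h0 : ∀ n, fourierInt n f = 0 := by
    intro n
    have := h n
    rw [inner_expL2] at this
    exact (mul_eq_zero.1 this).resolve_left hpi
  have hf : MemLp f 2 ((volume : Measure ℝ).restrict (Ioc (-Real.pi) Real.pi)) := by
    rw [restrict_Ioc_pi]
    exact Lp.memLp f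
  have hs := hasSum_sq_fourierCoeffOn neg_pi_lt_pi hf
  simp only [fourierCoeffOn_eq_fourierInt, h0, mul_zero, norm_zero, ne_eq, OfNat.ofNat_ne_zero,
    not_false_eq_true, zero_pow] at hs
  have hz := hs.unique hasSum_zero
  rw [smul_eq_zero, intervalIntegral.integral_of_le neg_pi_lt_pi.le,
    restrict_Ioc_pi] at hz
  have hz' := hz.resolve_left (inv_ne_zero (by linarith [Real.pi_pos]))
  have hself : inner ℂ f f = 0 := by
    rw [L2.inner_def]
    have : ∀ a, inner ℂ (f a) (f a) = ((‖f a‖ ^ 2 : ℝ) : ℂ) := fun a => by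
      rw [inner_self_eq_norm_sq_to_K]
      push_cast
      rfl
    simp only [this]
    rw [integral_complex_ofReal, hz', Complex.ofReal_zero]
  exact inner_self_eq_zero.1 hself

/-- The Fourier basis of `L²(-π, π)`. -/
noncomputable def fourierB : HilbertBasis ℤ ℂ L2 :=
  HilbertBasis.mkOfOrthogonalEqBot orthonormal_expL2 (by
    rw [Submodule.eq_bot_iff]
    intro f hf
    refine eq_zero_of_inner_expL2 fun n => ?_
    exact (Submodule.mem_orthogonal _ _).1 hf _ (Submodule.subset_span (mem_range_self n)))

/-- The normalized Fourier coefficients of a square integrable function. -/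
noncomputable def coeffL2 (f : L2) (n : ℤ) : ℂ := inner ℂ (expL2 n) f

theorem fourierB_repr (f : L2) (n : ℤ) : fourierB.repr f n = coeffL2 f n := by
  rw [HilbertBasis.repr_apply_apply, coeffL2, fourierB, HilbertBasis.coe_mkOfOrthogonalEqBot]

theorem continuous_coeffL2 (n : ℤ) : Continuous fun f : L2 => coeffL2 f n :=
  continuous_const.inner continuous_id

theorem coeffL2_sub (f g : L2) (n : ℤ) : coeffL2 (f - g) n = coeffL2 f n - coeffL2 g n :=
  inner_sub_right _ _ _

theorem coeffL2_smul (c : ℂ) (f : L2) (n : ℤ) : coeffL2 (c • f) n = c * coeffL2 f n :=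
  inner_smul_right _ _ _

theorem ext_coeffL2 {f g : L2} (h : ∀ n, coeffL2 f n = coeffL2 g n) : f = g :=
  sub_eq_zero.1 (eq_zero_of_inner_expL2 fun n => by
    have := coeffL2_sub f g n
    rwa [h n, sub_self] at this)

theorem hasSum_norm_coeffL2_sq (f : L2) : HasSum (fun n => ‖coeffL2 f n‖ ^ 2) (‖f‖ ^ 2) := by
  have h := lp.hasSum_norm (p := 2) (by norm_num) (fourierB.repr f)
  simpa [fourierB_repr] using h

theorem exists_coeffL2_eq {v : ℤ → ℂ} (hv : Summable fun n => ‖v n‖ ^ 2) :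
    ∃ f : L2, ∀ n, coeffL2 f n = v n := by
  have hm : Memℓp v 2 := memℓp_gen (by simpa using hv)
  refine ⟨fourierB.repr.symm ⟨v, hm⟩, fun n => ?_⟩
  rw [← fourierB_repr, LinearIsometryEquiv.apply_symm_apply]

/-- Dominated convergence for Fourier coefficients. -/
theorem tendsto_of_coeffL2 {F : ℕ → L2} {f : L2} {B : ℤ → ℝ} (hB : Summable fun n => B n ^ 2)
    (hle : ∀ k n, ‖coeffL2 (F k) n - coeffL2 f n‖ ≤ B n)
    (hlim : ∀ n, Tendsto (fun k => coeffL2 (F k) n) atTop (𝓝 (coeffL2 f n))) :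
    Tendsto F atTop (𝓝 f) := by
  rw [tendsto_iff_norm_sub_tendsto_zero]
  have h : Tendsto (fun k => ∑' n, ‖coeffL2 (F k - f) n‖ ^ 2) atTop (𝓝 (∑' _ : ℤ, (0 : ℝ))) := by
    refine tendsto_tsum_of_dominated_convergence hB (fun n => ?_) (.of_forall fun k n => ?_)
    · have := ((hlim n).sub_const (coeffL2 f n)).norm.pow 2
      simpa [coeffL2_sub] using this
    · rw [Real.norm_of_nonneg (by positivity), coeffL2_sub]
      gcongr
      exact hle k n
  simp only [(hasSum_norm_coeffL2_sq _).tsum_eq, tsum_zero] at h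
  have := h.sqrt
  simpa using this

/-! ### The operator in Fourier coordinates -/

/-- The action of the film-flow operator on Fourier coefficients. -/
noncomputable def filmCoeff (ε : ℝ) (v : ℤ → ℂ) (n : ℤ) : ℂ :=
  Complex.I * (n * v n + ε / 2 * (n * (n - 1) * v (n - 1) - n * (n + 1) * v (n + 1)))

theorem hasDerivAt_exp_neg (n : ℤ) (θ : ℝ) :
    HasDerivAt (fun t : ℝ => Complex.exp (-(Complex.I * n * t)))
      (-(Complex.I * n) * Complex.exp (-(Complex.I * n * θ))) θ := by
  have h : HasDerivAt (fun t : ℝ => -(Complex.I * n * t)) (-(Complex.I * n * 1)) θ :=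
    ((hasDerivAt_id θ).ofReal_comp.const_mul (Complex.I * n)).neg
  refine h.cexp.congr_deriv ?_
  ring

theorem exp_neg_pi_eq (n : ℤ) : Complex.exp (-(Complex.I * n * (Real.pi : ℝ)))
    = Complex.exp (-(Complex.I * n * ((-Real.pi : ℝ) : ℂ))) := by
  rw [Complex.exp_eq_exp_iff_exists_int]
  exact ⟨-n, by push_cast; ring⟩

theorem continuous_exp_neg (n : ℤ) :
    Continuous (fun t : ℝ => Complex.exp (-(Complex.I * n * t))) := by fun_prop

/-- Integration by parts; the boundary terms vanish because `sin` is zero at `±π`, and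
multiplication by `sin` shifts the frequency by `±1`. -/
theorem fourierInt_sin_mul_deriv {f : ℝ → ℂ} (hf : ContDiff ℝ 2 f) (n : ℤ) :
    fourierInt n (fun t => (Real.sin t : ℂ) * deriv f t)
      = 1 / 2 * ((n - 1) * fourierInt (n - 1) f - (n + 1) * fourierInt (n + 1) f) := by
  have hfd : Differentiable ℝ f := hf.differentiable (by norm_num)
  have hfc' : Continuous (deriv f) := hf.continuous_deriv (by norm_num)
  have hu : ∀ θ : ℝ, HasDerivAt
      (fun t : ℝ => Complex.exp (-(Complex.I * n * t)) * (Real.sin t : ℂ))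
      (-(1 / 2 * ((n - 1) * Complex.exp (-(Complex.I * ((n - 1 : ℤ) : ℂ) * θ))
        - (n + 1) * Complex.exp (-(Complex.I * ((n + 1 : ℤ) : ℂ) * θ))))) θ := by
    intro θ
    refine ((hasDerivAt_exp_neg n θ).mul (Real.hasDerivAt_sin θ).ofReal_comp).congr_deriv ?_
    have e1 : Complex.exp (-(Complex.I * ((n - 1 : ℤ) : ℂ) * θ))
        = Complex.exp (-(Complex.I * n * θ)) * (Complex.cos θ + Complex.sin θ * Complex.I) := by
      rw [← Complex.exp_mul_I, ← Complex.exp_add]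
      congr 1
      push_cast
      ring
    have e2 : Complex.exp (-(Complex.I * ((n + 1 : ℤ) : ℂ) * θ))
        = Complex.exp (-(Complex.I * n * θ)) * (Complex.cos θ - Complex.sin θ * Complex.I) := by
      have : Complex.cos θ - Complex.sin θ * Complex.I = Complex.exp (-θ * Complex.I) := by
        rw [Complex.exp_mul_I, Complex.cos_neg, Complex.sin_neg]
        ring
      rw [this, ← Complex.exp_add]
      congr 1
      push_cast
      ring
    rw [e1, e2]
    push_cast
    ring
  have hint : ∀ (m : ℤ) (g : ℝ → ℂ), Continuous g → IntervalIntegrable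
      (fun t : ℝ => Complex.exp (-(Complex.I * m * t)) * g t) volume (-Real.pi) Real.pi :=
    fun m g hg => ((continuous_exp_neg m).mul hg).intervalIntegrable _ _
  have hibp := intervalIntegral.integral_mul_deriv_eq_deriv_mul
    (a := -Real.pi) (b := Real.pi) (fun θ _ => hu θ) (fun θ _ => (hfd θ).hasDerivAt)
    (Continuous.intervalIntegrable (by fun_prop) _ _) (hfc'.intervalIntegrable _ _)
  simp only [Real.sin_neg, Real.sin_pi, neg_zero, Complex.ofReal_zero, mul_zero, zero_mul,
    sub_zero, zero_sub] at hibp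
  have e : fourierInt n (fun t => (Real.sin t : ℂ) * deriv f t)
      = ∫ θ in (-Real.pi)..Real.pi,
        Complex.exp (-(Complex.I * n * θ)) * (Real.sin θ : ℂ) * deriv f θ := by
    simp only [fourierInt, mul_assoc]
  rw [e, hibp, ← intervalIntegral.integral_neg]
  have e3 : ∀ θ : ℝ, -(-(1 / 2 * ((n - 1) * Complex.exp (-(Complex.I * ((n - 1 : ℤ) : ℂ) * θ))
        - (n + 1) * Complex.exp (-(Complex.I * ((n + 1 : ℤ) : ℂ) * θ)))) * f θ)
      = 1 / 2 * ((n - 1) * (Complex.exp (-(Complex.I * ((n - 1 : ℤ) : ℂ) * θ)) * f θ)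
        - (n + 1) * (Complex.exp (-(Complex.I * ((n + 1 : ℤ) : ℂ) * θ)) * f θ)) := by
    intro θ; ring
  simp only [e3]
  rw [intervalIntegral.integral_const_mul, intervalIntegral.integral_sub
    ((hint _ _ hf.continuous).const_mul _) ((hint _ _ hf.continuous).const_mul _),
    intervalIntegral.integral_const_mul, intervalIntegral.integral_const_mul]
  rfl

/-- The expression is the exact derivative `(ε sin θ f' + f)'`, so integrating by parts pulls out
the factor `n` that decouples the mode `0`. The boundary terms cancel by periodicity. -/
theorem fourierInt_filmExpr (ε : ℝ) (f : C2per) (n : ℤ) :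
    fourierInt n (filmExpr ε f.1) = filmCoeff ε (fun m => fourierInt m f.1) n := by
  have hf := f.2.1
  have hfd : Differentiable ℝ f.1 := hf.differentiable (by norm_num)
  have hs := contDiff_sin_mul_deriv hf
  have hK : ∀ θ : ℝ, HasDerivAt
      (fun t : ℝ => (ε : ℂ) * ((Real.sin t : ℂ) * deriv f.1 t) + f.1 t) (filmExpr ε f.1 θ) θ :=
    fun θ => ((hs.differentiable (by norm_num) θ).hasDerivAt.const_mul _).add
      (hfd θ).hasDerivAt
  have hibp := intervalIntegral.integral_mul_deriv_eq_deriv_mul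
    (a := -Real.pi) (b := Real.pi) (fun θ _ => hasDerivAt_exp_neg n θ) (fun θ _ => hK θ)
    (Continuous.intervalIntegrable (by fun_prop) _ _)
    ((continuous_filmExpr ε hf).intervalIntegrable _ _)
  have hper : f.1 Real.pi = f.1 (-Real.pi) := by
    have := f.2.2 (-Real.pi)
    rwa [show -Real.pi + 2 * Real.pi = Real.pi by ring] at this
  rw [exp_neg_pi_eq] at hibp
  simp only [Real.sin_neg, Real.sin_pi, neg_zero, Complex.ofReal_zero, mul_zero, zero_mul,
    hper, sub_self, zero_sub] at hibp
  rw [fourierInt, hibp, ← intervalIntegral.integral_neg]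
  have e3 : ∀ θ : ℝ, -(-(Complex.I * n) * Complex.exp (-(Complex.I * n * θ))
      * ((ε : ℂ) * ((Real.sin θ : ℂ) * deriv f.1 θ) + f.1 θ))
      = Complex.I * n * ((ε : ℂ) * (Complex.exp (-(Complex.I * n * θ))
        * ((Real.sin θ : ℂ) * deriv f.1 θ)) + Complex.exp (-(Complex.I * n * θ)) * f.1 θ) := by
    intro θ; ring
  have hint : ∀ {g : ℝ → ℂ}, Continuous g → IntervalIntegrable
      (fun t : ℝ => Complex.exp (-(Complex.I * n * t)) * g t) volume (-Real.pi) Real.pi :=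
    fun hg => ((continuous_exp_neg n).mul hg).intervalIntegrable _ _
  simp only [e3]
  rw [intervalIntegral.integral_const_mul, intervalIntegral.integral_add
    ((hint hs.continuous).const_mul _) (hint hf.continuous),
    intervalIntegral.integral_const_mul]
  change Complex.I * n * (ε * fourierInt n (fun t => (Real.sin t : ℂ) * deriv f.1 t)
    + fourierInt n f.1) = _
  rw [fourierInt_sin_mul_deriv hf, filmCoeff]
  ring

theorem coeffL2_toL2 (f : C2per) (n : ℤ) : coeffL2 (toL2 f) n
    = ((Real.sqrt (2 * Real.pi) : ℝ) : ℂ)⁻¹ * fourierInt n f.1 :=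
  inner_expL2_toLp n f.2.1.continuous

theorem coeffL2_filmMap (ε : ℝ) (f : C2per) (n : ℤ) :
    coeffL2 (filmMap ε f) n = filmCoeff ε (coeffL2 (toL2 f)) n := by
  have h : coeffL2 (filmMap ε f) n
      = ((Real.sqrt (2 * Real.pi) : ℝ) : ℂ)⁻¹ * fourierInt n (filmExpr ε f.1) :=
    inner_expL2_toLp n (continuous_filmExpr ε f.2.1)
  rw [h, fourierInt_filmExpr]
  simp only [filmCoeff, coeffL2_toL2]
  ring

/-! ### The closure of `H₀` and its eigenvalues -/

theorem mem_graph_H₀ {ε : ℝ} {p : L2 × L2} :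
    p ∈ (H₀ ε).graph ↔ ∃ f : C2per, toL2 f = p.1 ∧ filmMap ε f = p.2 := by
  rw [LinearPMap.mem_graph_iff]
  constructor
  · rintro ⟨⟨y, hy⟩, h1, h2⟩
    obtain ⟨f, rfl⟩ := hy
    exact ⟨f, h1, by rw [← h2]; exact (H₀_apply ε f).symm⟩
  · rintro ⟨f, h1, h2⟩
    exact ⟨⟨toL2 f, LinearMap.mem_range_self toL2 f⟩, h1, by rw [← h2]; exact H₀_apply ε f⟩

/-- For fixed `n` the relation involves finitely many Fourier coefficients, each continuous on `L²`,
so it passes from the graph to its closure. -/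
theorem coeffL2_of_mem_closure {ε : ℝ} {p : L2 × L2} (hp : p ∈ (H₀ ε).graph.topologicalClosure)
    (n : ℤ) : coeffL2 p.2 n = filmCoeff ε (coeffL2 p.1) n := by
  have hc := continuous_coeffL2
  have hcl : _root_.IsClosed {q : L2 × L2 | coeffL2 q.2 n = filmCoeff ε (coeffL2 q.1) n} := by
    refine isClosed_eq ((hc n).comp continuous_snd) ?_
    have h1 : ∀ m, Continuous fun q : L2 × L2 => coeffL2 q.1 m :=
      fun m => (hc m).comp continuous_fst
    unfold filmCoeff
    have h2 := h1 n
    have h3 := h1 (n - 1)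
    have h4 := h1 (n + 1)
    fun_prop
  have hsub : ((H₀ ε).graph : Set (L2 × L2)) ⊆
      {q : L2 × L2 | coeffL2 q.2 n = filmCoeff ε (coeffL2 q.1) n} := by
    intro q hq
    obtain ⟨f, h1, h2⟩ := mem_graph_H₀.1 hq
    rw [mem_ofPred_eq, ← h1, ← h2]
    exact coeffL2_filmMap ε f n
  have hp' : p ∈ closure ((H₀ ε).graph : Set (L2 × L2)) := by
    rw [← Submodule.topologicalClosure_coe]
    exact hp
  exact closure_minimal hsub hcl hp'

/-- In the closure of the graph the first component determines all Fourier coefficients of the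
second, so the closure is still a graph. -/
theorem isClosable_H₀ (ε : ℝ) : (H₀ ε).IsClosable := by
  refine ⟨(H₀ ε).graph.topologicalClosure.toLinearPMap,
    (Submodule.toLinearPMap_graph_eq _ fun x hx h0 => ?_).symm⟩
  refine ext_coeffL2 fun n => ?_
  have h := coeffL2_of_mem_closure hx n
  rw [h0] at h
  rw [h]
  simp [filmCoeff, coeffL2]

theorem isEigenvalue_iff {ε : ℝ} {z : ℂ} : IsEigenvalue ((-Complex.I) • H ε) z ↔
    ∃ f : L2, f ≠ 0 ∧ (f, (Complex.I * z) • f) ∈ (H₀ ε).graph.topologicalClosure := by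
  rw [(isClosable_H₀ ε).graph_closure_eq_closure_graph]
  constructor
  · rintro ⟨⟨f, hf⟩, h0, hz⟩
    refine ⟨f, h0, (LinearPMap.mem_graph_iff _).2 ⟨⟨f, hf⟩, rfl, ?_⟩⟩
    have hz' : (-Complex.I) • (H ε) ⟨f, hf⟩ = z • f := hz
    have : (H ε) ⟨f, hf⟩ = Complex.I • ((-Complex.I) • (H ε) ⟨f, hf⟩) := by
      rw [smul_smul]; simp
    change (H ε) ⟨f, hf⟩ = _
    rw [this, hz', smul_smul]
  · rintro ⟨f, h0, hf⟩
    obtain ⟨y, hy1, hy2⟩ := (LinearPMap.mem_graph_iff _).1 hf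
    refine ⟨y, by rw [hy1]; exact h0, ?_⟩
    change (-Complex.I) • (H ε) y = _
    have : (H ε) y = (Complex.I * z) • f := hy2
    rw [this, smul_smul, hy1]
    congr 1
    linear_combination -z * Complex.I_sq

/-! ### Approximation by triangularly cut-off Fourier series -/

/-- The triangular cutoff. -/
noncomputable def cutoff (k : ℕ) (n : ℤ) : ℝ := max 0 (1 - |(n : ℝ)| / (k + 1))

theorem cutoff_nonneg (k : ℕ) (n : ℤ) : 0 ≤ cutoff k n := le_max_left _ _

theorem cutoff_le_one (k : ℕ) (n : ℤ) : cutoff k n ≤ 1 := by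
  refine max_le zero_le_one ?_
  have : 0 ≤ |(n : ℝ)| / (k + 1) := by positivity
  linarith

theorem cutoff_eq_zero {k : ℕ} {n : ℤ} (h : (k : ℝ) + 1 ≤ |(n : ℝ)|) : cutoff k n = 0 := by
  refine max_eq_left ?_
  have : 1 ≤ |(n : ℝ)| / (k + 1) := (one_le_div (by positivity)).2 h
  linarith

theorem tendsto_cutoff (n : ℤ) : Tendsto (fun k => cutoff k n) atTop (𝓝 1) := by
  have h : Tendsto (fun k : ℕ => 1 - |(n : ℝ)| / ((k : ℝ) + 1)) atTop (𝓝 (1 - 0)) := by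
    refine tendsto_const_nhds.sub ?_
    have := tendsto_one_div_add_atTop_nhds_zero_nat (𝕜 := ℝ) |>.const_mul |(n : ℝ)|
    simpa [div_eq_mul_inv] using this
  have h2 := (tendsto_const_nhds (x := (0 : ℝ))).max h
  simpa [cutoff] using h2

/-- The cutoff has slope at most `1 / (k + 1)` and is constant, equal to `0`, near any `n` with `|n|
≥ k + 2`; otherwise `|n| < k + 2 ≤ 2 (k + 1)`. -/
theorem abs_mul_cutoff_sub_le (k : ℕ) {m n : ℤ} (h : |m - n| = 1) :
    |(n : ℝ)| * |cutoff k m - cutoff k n| ≤ 2 := by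
  have hk : (0 : ℝ) < (k : ℝ) + 1 := by positivity
  have h1 : |(m : ℝ) - n| = 1 := by exact_mod_cast h
  have h2 : |(|(m : ℝ)| - |(n : ℝ)|)| ≤ 1 := (abs_abs_sub_abs_le _ _).trans h1.le
  by_cases hn : (k : ℝ) + 2 ≤ |(n : ℝ)|
  · have hm : (k : ℝ) + 1 ≤ |(m : ℝ)| := by linarith [(abs_le.1 h2).1]
    rw [cutoff_eq_zero hm, cutoff_eq_zero (by linarith)]
    simp
  · have h3 : |cutoff k m - cutoff k n| ≤ 1 / ((k : ℝ) + 1) := by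
      refine (abs_max_sub_max_le_max _ _ _ _).trans (max_le (by simp; positivity) ?_)
      have : (1 - |(m : ℝ)| / ((k : ℝ) + 1)) - (1 - |(n : ℝ)| / ((k : ℝ) + 1))
          = -((|(m : ℝ)| - |(n : ℝ)|) / ((k : ℝ) + 1)) := by ring
      rw [this, abs_neg, abs_div, abs_of_pos hk]
      gcongr
    calc _ ≤ ((k : ℝ) + 2) * (1 / ((k : ℝ) + 1)) := by
          gcongr
          linarith
      _ ≤ 2 := by
          rw [mul_one_div, div_le_iff₀ hk]
          linarith [(Nat.cast_nonneg k : (0 : ℝ) ≤ k)]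

theorem exists_trigPoly (a : ℤ → ℂ) (s : Finset ℤ) (ha : ∀ n, n ∉ s → a n = 0) :
    ∃ f : C2per, ∀ n, coeffL2 (toL2 f) n = a n := by
  refine ⟨∑ m ∈ s, (a m * ((Real.sqrt (2 * Real.pi) : ℝ) : ℂ)⁻¹) • expPer m, fun n => ?_⟩
  have e : ∀ m, coeffL2 (((Real.sqrt (2 * Real.pi) : ℝ) : ℂ)⁻¹ • toL2 (expPer m)) n
      = if n = m then 1 else 0 := fun m => orthonormal_iff_ite.1 orthonormal_expL2 n m
  simp only [map_sum, map_smul, mul_smul]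
  rw [coeffL2, inner_sum]
  change ∑ m ∈ s, coeffL2 (a m • ((Real.sqrt (2 * Real.pi) : ℝ) : ℂ)⁻¹ • toL2 (expPer m)) n = _
  simp only [coeffL2_smul, e, mul_ite, mul_one, mul_zero, Finset.sum_ite_eq]
  split_ifs with h
  · rfl
  · exact (ha n h).symm

theorem norm_cutoff_sub_one_le (k : ℕ) (n : ℤ) : ‖(cutoff k n : ℂ) - 1‖ ≤ 1 := by
  have : (cutoff k n : ℂ) - 1 = ((cutoff k n - 1 : ℝ) : ℂ) := by push_cast; rfl
  rw [this, Complex.norm_real, Real.norm_eq_abs, abs_le]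
  constructor <;> linarith [cutoff_nonneg k n, cutoff_le_one k n]

theorem tendsto_cutoff_ofReal (n : ℤ) : Tendsto (fun k => (cutoff k n : ℂ)) atTop (𝓝 1) := by
  have := (Complex.continuous_ofReal.tendsto 1).comp (tendsto_cutoff n)
  rwa [Complex.ofReal_one] at this

theorem norm_mul_cutoff_sub_le (k : ℕ) {m n : ℤ} (h : |m - n| = 1) :
    ‖(n : ℂ) * ((cutoff k m : ℂ) - cutoff k n)‖ ≤ 2 := by
  have : (n : ℂ) * ((cutoff k m : ℂ) - cutoff k n)
      = (((n : ℝ) * (cutoff k m - cutoff k n) : ℝ) : ℂ) := by push_cast; rfl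
  rw [this, Complex.norm_real, Real.norm_eq_abs, abs_mul]
  exact abs_mul_cutoff_sub_le k h

theorem summable_sq_add_shift {v w : ℤ → ℝ} (hv : Summable fun n => v n ^ 2)
    (hw : Summable fun n => w n ^ 2) (a b : ℝ) :
    Summable fun n : ℤ => (a * v n + b * (w (n - 1) + w (n + 1))) ^ 2 := by
  have h1 : Summable fun n : ℤ => w (n - 1) ^ 2 := 
    (Equiv.subRight (1 : ℤ)).summable_iff (f := fun n => w n ^ 2) |>.2 hw
  have h2 : Summable fun n : ℤ => w (n + 1) ^ 2 := 
    (Equiv.addRight (1 : ℤ)).summable_iff (f := fun n => w n ^ 2) |>.2 hw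
  refine Summable.of_nonneg_of_le (fun _ => sq_nonneg _) (fun n => ?_)
    (((hv.mul_left (2 * a ^ 2)).add (h1.mul_left (4 * b ^ 2))).add (h2.mul_left (4 * b ^ 2)))
  have e : 2 * a ^ 2 * v n ^ 2 + 4 * b ^ 2 * w (n - 1) ^ 2 + 4 * b ^ 2 * w (n + 1) ^ 2
      - (a * v n + b * (w (n - 1) + w (n + 1))) ^ 2
      = (a * v n - b * (w (n - 1) + w (n + 1))) ^ 2 + 2 * (b * (w (n - 1) - w (n + 1))) ^ 2 := by
    ring
  rw [← sub_nonneg, e]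
  positivity

/-- The commutator of the cutoff with the operator is dominated. -/
theorem norm_commutator_le (ε : ℝ) (k : ℕ) (n : ℤ) (y a b : ℂ) :
    ‖((cutoff k n : ℂ) - 1) * y + Complex.I * (ε / 2) *
        ((n * ((cutoff k (n - 1) : ℂ) - cutoff k n)) * a
          - (n * ((cutoff k (n + 1) : ℂ) - cutoff k n)) * b)‖ ≤ ‖y‖ + |ε| * (‖a‖ + ‖b‖) := by
  have e1 : ‖Complex.I * (ε / 2)‖ = |ε| / 2 := by simp
  refine (norm_add_le _ _).trans (add_le_add ?_ ?_)
  · rw [norm_mul]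
    exact mul_le_of_le_one_left (norm_nonneg _) (norm_cutoff_sub_one_le k n)
  · rw [norm_mul, e1]
    have h1 := norm_mul_cutoff_sub_le k (m := n - 1) (n := n) (by simp)
    have h2 := norm_mul_cutoff_sub_le k (m := n + 1) (n := n) (by simp)
    calc _ ≤ |ε| / 2 * (2 * ‖a‖ + 2 * ‖b‖) := by
          refine mul_le_mul_of_nonneg_left ((norm_sub_le _ _).trans ?_) (by positivity)
          rw [norm_mul _ a, norm_mul _ b]
          exact add_le_add (mul_le_mul_of_nonneg_right h1 (norm_nonneg _))
            (mul_le_mul_of_nonneg_right h2 (norm_nonneg _))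
      _ = _ := by ring

theorem tendsto_commutator (ε : ℝ) (n : ℤ) (y a b : ℂ) :
    Tendsto (fun k => ((cutoff k n : ℂ) - 1) * y + Complex.I * (ε / 2) *
        ((n * ((cutoff k (n - 1) : ℂ) - cutoff k n)) * a
          - (n * ((cutoff k (n + 1) : ℂ) - cutoff k n)) * b)) atTop (𝓝 0) := by
  have hl := tendsto_cutoff_ofReal
  have h := (((hl n).sub_const 1).mul_const y).add
    (((((hl (n - 1)).sub (hl n)).const_mul (n : ℂ)).mul_const a).sub
      ((((hl (n + 1)).sub (hl n)).const_mul (n : ℂ)).mul_const b)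
        |>.const_mul (Complex.I * (ε / 2)))
  simpa only [sub_self, zero_mul, mul_zero, add_zero] using h

/-- A function whose derivative is square integrable and which formally satisfies the eigenvalue
equation belongs to the domain of the closure. -/
theorem mem_closure_of_summable {ε : ℝ} {z : ℂ} {f : L2} {v : ℤ → ℂ}
    (hv : ∀ n, coeffL2 f n = v n) (hu : Summable fun n : ℤ => ‖(n : ℂ) * v n‖ ^ 2)
    (hz : ∀ n, Complex.I * z * v n = filmCoeff ε v n) :
    (f, (Complex.I * z) • f) ∈ (H₀ ε).graph.topologicalClosure := by
  have hvs : Summable fun n => ‖v n‖ ^ 2 := by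
    simpa only [hv] using (hasSum_norm_coeffL2_sq f).summable
  have hF : ∀ k : ℕ, ∃ F : C2per, ∀ n, coeffL2 (toL2 F) n = cutoff k n * v n := by
    intro k
    refine exists_trigPoly _ (Finset.Icc (-(k : ℤ)) k) fun n hn => ?_
    have h1 : (k : ℤ) + 1 ≤ |n| := by
      rw [Finset.mem_Icc, ← abs_le] at hn
      omega
    have h2 : (k : ℝ) + 1 ≤ |(n : ℝ)| := by exact_mod_cast h1
    rw [cutoff_eq_zero h2, Complex.ofReal_zero, zero_mul]
  choose F hF using hF
  have hlim1 : Tendsto (fun k => toL2 (F k)) atTop (𝓝 f) := by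
    refine tendsto_of_coeffL2 (B := fun n => ‖v n‖) hvs (fun k n => ?_) fun n => ?_
    · rw [hF, hv]
      have : (cutoff k n : ℂ) * v n - v n = ((cutoff k n : ℂ) - 1) * v n := by ring
      rw [this, norm_mul]
      exact mul_le_of_le_one_left (norm_nonneg _) (norm_cutoff_sub_one_le k n)
    · simp only [hF, hv]
      have := (tendsto_cutoff_ofReal n).mul_const (v n)
      rwa [one_mul] at this
  -- Moving the cutoff through the operator leaves a commutator: the second-order growth `n (n ± 1)`
  -- is met by a difference of neighbouring cutoffs, which absorbs one factor `n`. What remains is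
  -- dominated by the square summable `n v n`.
  have hdiff : ∀ k (n : ℤ), coeffL2 (filmMap ε (F k)) n - coeffL2 ((Complex.I * z) • f) n
      = ((cutoff k n : ℂ) - 1) * (Complex.I * z * v n) + Complex.I * (ε / 2) *
        ((n * ((cutoff k (n - 1) : ℂ) - cutoff k n)) * (((n - 1 : ℤ) : ℂ) * v (n - 1))
          - (n * ((cutoff k (n + 1) : ℂ) - cutoff k n)) * (((n + 1 : ℤ) : ℂ) * v (n + 1))) := by
    intro k n
    rw [coeffL2_filmMap, coeffL2_smul, hv, hz]
    simp only [filmCoeff, hF]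
    push_cast
    ring
  have hlim2 : Tendsto (fun k => filmMap ε (F k)) atTop (𝓝 ((Complex.I * z) • f)) := by
    refine tendsto_of_coeffL2 (summable_sq_add_shift hvs hu ‖z‖ |ε|) (fun k n => ?_) fun n => ?_
    · rw [hdiff]
      refine (norm_commutator_le _ _ _ _ _ _).trans (le_of_eq ?_)
      rw [norm_mul, norm_mul, Complex.norm_I, one_mul]
    · rw [← tendsto_sub_nhds_zero_iff]
      simp only [hdiff]
      exact tendsto_commutator _ _ _ _ _
  have := hlim1.prodMk_nhds hlim2
  rw [← SetLike.mem_coe, Submodule.topologicalClosure_coe]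
  refine mem_closure_of_tendsto this (.of_forall fun k => ?_)
  exact mem_graph_H₀.2 ⟨F k, rfl, rfl⟩

/-! ### Eigenvalues and zeros of the secular function -/

section Eigenvalues

variable {ε : ℝ} {z : ℂ}

/-- The term `v n` carries the factor `n`, so `v 0` never enters and `v 1` determines the whole
positive part. -/
theorem eq_mul_vSeq (hε : 0 < ε) {v : ℕ → ℂ}
    (h : ∀ n : ℕ, z * v (n + 1) = (n + 1) * v (n + 1)
      + ε / 2 * ((n + 1) * n * v n - (n + 1) * (n + 2) * v (n + 2))) (n : ℕ) :
    v (n + 1) = v 1 * vSeq (1 / ε) z (n + 1) := by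
  have hε' : (ε : ℂ) ≠ 0 := Complex.ofReal_ne_zero.2 hε.ne'
  have key : ∀ n : ℕ, n * v n = v 1 * uSeq (1 / ε) z n ∧
      ((n : ℂ) + 1) * v (n + 1) = v 1 * uSeq (1 / ε) z (n + 1) := by
    intro n
    induction n with
    | zero => simp [uSeq, threeTerm]
    | succ n ih =>
      refine ⟨by exact_mod_cast ih.2, ?_⟩
      have hn := natCast_add_one_ne n
      have e := h n
      have e2 : ((n : ℂ) + 2) * v (n + 2)
          = n * v n + 2 / ε / (n + 1) * ((n + 1 - z) * v (n + 1)) := by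
        field_simp
        linear_combination 2 * e
      have e3 : ((n : ℂ) + 1 - z) * v (n + 1)
          = (1 - z / (n + 1)) * (((n : ℂ) + 1) * v (n + 1)) := by field_simp
      rw [e3, ih.1, ih.2] at e2
      rw [uSeq_succ_succ]
      push_cast
      have e4 : ((n : ℂ) + 1 + 1) * v (n + 1 + 1) = ((n : ℂ) + 2) * v (n + 2) := by ring_nf
      rw [e4, e2]
      ring
  have hn := natCast_add_one_ne n
  refine mul_left_cancel₀ hn ?_
  rw [(key n).2, ← add_one_mul_vSeq]
  ring

theorem one_div_gt_half (hε0 : 0 < ε) (hε2 : ε < 2) : 1 / 2 < 1 / ε :=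
  one_div_lt_one_div_of_lt hε0 hε2

theorem secular_eq_zero_of_recurrence (hε0 : 0 < ε) (hε2 : ε < 2) {v : ℕ → ℂ}
    (hv : Summable fun n => ‖v n‖ ^ 2) (hne : ∃ n, v (n + 1) ≠ 0)
    (h : ∀ n : ℕ, z * v (n + 1) = (n + 1) * v (n + 1)
      + ε / 2 * ((n + 1) * n * v n - (n + 1) * (n + 2) * v (n + 2))) :
    secular (1 / ε) z = 0 := by
  have hw := eq_mul_vSeq hε0 h
  have h1 : v 1 ≠ 0 := by
    intro h1
    obtain ⟨n, hn⟩ := hne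
    rw [hw, h1, zero_mul] at hn
    exact hn rfl
  refine secular_eq_zero_of_summable (one_div_gt_half hε0 hε2) ?_
  refine (summable_nat_add_iff 1).1 ((((summable_nat_add_iff 1).2 hv).mul_left
    (‖v 1‖⁻¹ ^ 2)).congr fun n => ?_)
  rw [hw n, norm_mul, mul_pow, ← mul_assoc, ← mul_pow, inv_mul_cancel₀ (norm_ne_zero_iff.2 h1),
    one_pow, one_mul]

/-- The reflection symmetry: it reduces the negative modes with eigenvalue `z` to the positive modes
with eigenvalue `-z`. -/
theorem filmCoeff_comp_neg (ε : ℝ) (v : ℤ → ℂ) (n : ℤ) :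
    filmCoeff ε (fun m => v (-m)) n = -filmCoeff ε v (-n) := by
  have e1 : -(n - 1) = -n + 1 := by ring
  have e2 : -(n + 1) = -n - 1 := by ring
  simp only [filmCoeff, e1, e2]
  push_cast
  ring

theorem secular_eq_zero_of_pos (hε0 : 0 < ε) (hε2 : ε < 2) {v : ℤ → ℂ}
    (hv : Summable fun n => ‖v n‖ ^ 2) (hz : ∀ n, Complex.I * z * v n = filmCoeff ε v n)
    {m : ℤ} (hm : 0 < m) (hne : v m ≠ 0) : secular (1 / ε) z = 0 := by
  obtain ⟨k, rfl⟩ : ∃ k : ℕ, m = (k : ℤ) + 1 := ⟨(m - 1).toNat, by omega⟩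
  refine secular_eq_zero_of_recurrence hε0 hε2 (v := fun n : ℕ => v n)
    (hv.comp_injective Nat.cast_injective) ⟨k, by simpa using hne⟩ fun n => ?_
  have h := hz ((n : ℤ) + 1)
  have e1 : (n : ℤ) + 1 - 1 = n := by ring
  have e2 : (n : ℤ) + 1 + 1 = ((n + 2 : ℕ) : ℤ) := by push_cast; ring
  rw [filmCoeff, mul_assoc] at h
  have h' := mul_left_cancel₀ Complex.I_ne_zero h
  rw [e1, e2] at h'
  push_cast at h' ⊢
  rw [h']
  ring

/-- The three cases are the sign of a mode that the eigenfunction charges: the row `n = 0` of the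
operator is zero and forces `z = 0`, while the other two lead to the secular equation. -/
theorem eigenvalue_cases (hε0 : 0 < ε) (hε2 : ε < 2)
    (h : IsEigenvalue ((-Complex.I) • H ε) z) :
    z = 0 ∨ secular (1 / ε) z = 0 ∨ secular (1 / ε) (-z) = 0 := by
  obtain ⟨f, hf0, hf⟩ := isEigenvalue_iff.1 h
  have hrel : ∀ n, Complex.I * z * coeffL2 f n = filmCoeff ε (coeffL2 f) n := fun n => by
    have := coeffL2_of_mem_closure hf n
    rwa [coeffL2_smul] at this
  have hs := (hasSum_norm_coeffL2_sq f).summable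
  obtain ⟨m, hm⟩ : ∃ m, coeffL2 f m ≠ 0 := by
    by_contra! hc
    exact hf0 (eq_zero_of_inner_expL2 hc)
  rcases lt_trichotomy m 0 with hm0 | rfl | hm0
  · refine Or.inr (Or.inr ?_)
    refine secular_eq_zero_of_pos hε0 hε2 (v := fun n => coeffL2 f (-n))
      ((Equiv.neg ℤ).summable_iff (f := fun n => ‖coeffL2 f n‖ ^ 2) |>.2 hs) (fun n => ?_)
      (m := -m) (by omega) (by simpa using hm)
    rw [filmCoeff_comp_neg, ← hrel]
    ring
  · left
    have := hrel 0
    simp only [filmCoeff, Int.cast_zero, zero_mul, sub_self, mul_zero, add_zero,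
      mul_eq_zero, Complex.I_ne_zero, false_or, hm, or_false] at this
    exact this
  · exact Or.inr (Or.inl (secular_eq_zero_of_pos hε0 hε2 hs hrel hm0 hm))

theorem isEigenvalue_of_coeff {v : ℤ → ℂ} (hne : ∃ n, v n ≠ 0)
    (hv : Summable fun n => ‖v n‖ ^ 2) (hu : Summable fun n : ℤ => ‖(n : ℂ) * v n‖ ^ 2)
    (hz : ∀ n, Complex.I * z * v n = filmCoeff ε v n) :
    IsEigenvalue ((-Complex.I) • H ε) z := by
  obtain ⟨f, hf⟩ := exists_coeffL2_eq hv
  refine isEigenvalue_iff.2 ⟨f, ?_, mem_closure_of_summable hf hu hz⟩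
  rintro rfl
  obtain ⟨n, hn⟩ := hne
  rw [← hf n] at hn
  exact hn (inner_zero_right _)

/-- The eigenfunction is a constant; in the rows `n = 1` and `n = -1` its coefficient is multiplied
by `n - 1` and `n + 1`, which are zero. -/
theorem isEigenvalue_zero (ε : ℝ) : IsEigenvalue ((-Complex.I) • H ε) 0 := by
  have hs : ∀ w : ℤ → ℂ, (∀ n, n ≠ 0 → w n = 0) → Summable fun n => ‖w n‖ ^ 2 := fun w hw =>
    summable_of_ne_finset_zero (s := {0}) fun n hn => by
      rw [hw n (by simpa using hn)]; simp
  refine isEigenvalue_of_coeff (v := fun n => if n = 0 then 1 else 0) ⟨0, by simp⟩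
    (hs _ fun n hn => if_neg hn) (hs _ fun n hn => by simp [hn]) fun n => ?_
  simp only [filmCoeff]
  rcases eq_or_ne n 0 with rfl | h0
  · simp
  rcases eq_or_ne n 1 with rfl | h1
  · norm_num
  rcases eq_or_ne n (-1) with rfl | h2
  · norm_num
  · have h3 : n - 1 ≠ 0 := by omega
    have h4 : n + 1 ≠ 0 := by omega
    simp [h0, h3, h4]

/-- The eigenfunction coefficients extended by zero to the integers. -/
noncomputable def vExt (α : ℝ) (z : ℂ) (n : ℤ) : ℂ := if 0 ≤ n then vSeq α z n.toNat else 0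

theorem vExt_natCast (α : ℝ) (z : ℂ) (n : ℕ) : vExt α z n = vSeq α z n := by simp [vExt]

theorem vExt_of_nonpos (α : ℝ) (z : ℂ) {n : ℤ} (hn : n ≤ 0) : vExt α z n = 0 := by
  rcases hn.lt_or_eq with h | rfl
  · exact if_neg (by omega)
  · simp [vExt, vSeq_zero]

theorem vExt_relation (hε : 0 < ε) (n : ℤ) :
    Complex.I * z * vExt (1 / ε) z n = filmCoeff ε (vExt (1 / ε) z) n := by
  have hε' : (ε : ℂ) ≠ 0 := Complex.ofReal_ne_zero.2 hε.ne'
  rcases le_or_gt n 0 with hn | hn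
  -- In the row `n = 0` the coefficient `v 1` is nonzero but is multiplied by `n`, so extension by
  -- zero remains a solution.
  · rw [filmCoeff, vExt_of_nonpos _ _ hn, vExt_of_nonpos _ _ (by omega : n - 1 ≤ 0)]
    rcases eq_or_ne n 0 with rfl | h0
    · simp
    rw [vExt_of_nonpos _ _ (by omega : n + 1 ≤ 0)]
    simp
  · obtain ⟨k, rfl⟩ : ∃ k : ℕ, n = ((k + 1 : ℕ) : ℤ) := ⟨(n - 1).toNat, by omega⟩
    have e1 : ((k + 1 : ℕ) : ℤ) - 1 = k := by push_cast; ring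
    have e2 : ((k + 1 : ℕ) : ℤ) + 1 = ((k + 2 : ℕ) : ℤ) := by push_cast; ring
    rw [filmCoeff, e1, e2, vExt_natCast, vExt_natCast, vExt_natCast]
    have h0 : (k : ℂ) * vSeq (1 / ε) z k = uSeq (1 / ε) z k := by
      rcases k with _ | k
      · simp [uSeq, threeTerm]
      · exact_mod_cast add_one_mul_vSeq k
    have h1 := add_one_mul_vSeq (α := 1 / ε) (lam := z) k
    have h2 := add_one_mul_vSeq (α := 1 / ε) (lam := z) (k + 1)
    have h3 := uSeq_succ_succ (α := 1 / ε) (lam := z) k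
    have hk := natCast_add_one_ne k
    rw [← h2, ← h1, ← h0] at h3
    push_cast at h3 ⊢
    have h4 : (ε : ℂ) * (((k : ℂ) + 1 + 1) * vSeq (1 / ε) z (k + 2))
        = ε * (k * vSeq (1 / ε) z k) + 2 * (1 - z / (k + 1)) * vSeq (1 / ε) z (k + 1) := by
      rw [h3]
      field_simp
    have h5 : ((k : ℂ) + 1) * (1 - z / (k + 1)) = k + 1 - z := by field_simp
    linear_combination (Complex.I * (k + 1) / 2) * h4
      + Complex.I * vSeq (1 / ε) z (k + 1) * h5

theorem summable_int_of_nat {w : ℤ → ℂ} (h0 : ∀ n : ℤ, n ≤ 0 → w n = 0)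
    (h : Summable fun n : ℕ => ‖w n‖ ^ 2) : Summable fun n => ‖w n‖ ^ 2 := by
  refine Summable.of_nat_of_neg (f := fun n => ‖w n‖ ^ 2) h ?_
  refine summable_zero.congr fun n => ?_
  rw [h0 _ (by omega)]
  simp

/-- The sequence `vExt` gives the eigenvalue `z`, and its reflection gives `-z`. Square summability
of `uSeq` supplies the condition on `n v n`, and that on `v n` a fortiori. -/
theorem isEigenvalue_of_secular (hε0 : 0 < ε) (hε2 : ε < 2) (h : secular (1 / ε) z = 0) :
    IsEigenvalue ((-Complex.I) • H ε) z ∧ IsEigenvalue ((-Complex.I) • H ε) (-z) := by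
  have hα := one_div_gt_half hε0 hε2
  have hU := summable_uSeq_of_secular_eq_zero hα h
  have hne : vExt (1 / ε) z 1 ≠ 0 := by
    have := vExt_natCast (1 / ε) z 1
    rw [vSeq_one, Nat.cast_one] at this
    rw [this]
    exact one_ne_zero
  have hv : Summable fun n => ‖vExt (1 / ε) z n‖ ^ 2 := by
    refine summable_int_of_nat (fun n hn => vExt_of_nonpos _ _ hn) ?_
    refine hU.of_nonneg_of_le (fun _ => sq_nonneg _) fun n => ?_
    rw [vExt_natCast, vSeq, norm_div, Complex.norm_natCast]
    gcongr
    rcases Nat.eq_zero_or_pos n with rfl | hk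
    · simp
    · exact div_le_self (norm_nonneg _) (by exact_mod_cast hk)
  have hu : Summable fun n : ℤ => ‖(n : ℂ) * vExt (1 / ε) z n‖ ^ 2 := by
    refine summable_int_of_nat (fun n hn => by rw [vExt_of_nonpos _ _ hn, mul_zero]) ?_
    refine hU.congr fun n => ?_
    rw [vExt_natCast, Int.cast_natCast]
    rcases n with _ | k
    · simp [uSeq, threeTerm]
    · rw [← add_one_mul_vSeq]
      push_cast
      rfl
  refine ⟨isEigenvalue_of_coeff ⟨1, hne⟩ hv hu (vExt_relation hε0), ?_⟩
  refine isEigenvalue_of_coeff (v := fun n => vExt (1 / ε) z (-n)) ⟨-1, by simpa using hne⟩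
    ((Equiv.neg ℤ).summable_iff (f := fun n => ‖vExt (1 / ε) z n‖ ^ 2) |>.2 hv)
    (((Equiv.neg ℤ).summable_iff (f := fun n : ℤ => ‖(n : ℂ) * vExt (1 / ε) z n‖ ^ 2)
      |>.2 hu).congr fun n => ?_) fun n => ?_
  · simp
  · rw [filmCoeff_comp_neg, ← vExt_relation hε0]
    ring

/-! ### Enumeration -/

/-- The secular function has finitely many zeros in every disc. -/
theorem finite_zeros_secular {α : ℝ} (hα : 0 < α) (R : ℝ) :
    {w : ℂ | secular α w = 0 ∧ ‖w‖ ≤ R}.Finite := by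
  by_contra hinf
  obtain ⟨w, -, hw⟩ := Set.Infinite.exists_accPt_of_subset_isCompact hinf
    (isCompact_closedBall (0 : ℂ) R) fun w hw => by simpa using hw.2
  have han : AnalyticOnNhd ℂ (secular α) univ :=
    fun w _ => (differentiable_secular hα).analyticAt w
  have hfr : ∃ᶠ x in 𝓝[≠] w, secular α x = 0 :=
    (accPt_iff_frequently_nhdsNE.1 hw).mono fun x hx => hx.1
  have h0 := han.eqOn_zero_of_preconnected_of_frequently_eq_zero isPreconnected_univ
    (mem_univ w) hfr (mem_univ (-((0 : ℝ) : ℂ)))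
  have h1 := one_le_secular_neg_re hα (s := 0) le_rfl
  rw [h0] at h1
  simp at h1
  linarith

/-- An infinite set of reals that is finite below every bound is the range of a strictly
increasing sequence tending to infinity. -/
theorem exists_enumeration {S : Set ℝ} (hS : S.Infinite) (hfin : ∀ R, (S ∩ Iic R).Finite) :
    ∃ φ : ℕ → ℝ, StrictMono φ ∧ range φ = S ∧ Tendsto φ atTop atTop := by
  -- Finiteness below each bound makes `S` well ordered, so the enumeration can take the least
  -- element and then repeatedly the next one.
  have hmin : ∀ T ⊆ S, T.Nonempty → ∃ t, IsLeast T t := by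
    rintro T hT ⟨t, ht⟩
    obtain ⟨m, hm, hle⟩ := exists_min_image (T ∩ Iic t) id
      ((hfin t).subset (inter_subset_inter_left _ hT)) ⟨t, ht, mem_Iic.2 le_rfl⟩
    refine ⟨m, hm.1, fun x hx => ?_⟩
    rcases le_total x t with h | h
    · exact hle x ⟨hx, h⟩
    · exact (mem_Iic.1 hm.2).trans h
  have hnext : ∀ x : ℝ, ∃ y, IsLeast (S ∩ Ioi x) y := fun x => by
    refine hmin _ inter_subset_left ?_
    by_contra hc
    refine hS ((hfin x).subset fun y hy => ⟨hy, ?_⟩)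
    by_contra hxy
    exact hc ⟨y, hy, mem_Ioi.2 (not_le.1 hxy)⟩
  choose next hn using hnext
  obtain ⟨m, hm⟩ := hmin S subset_rfl hS.nonempty
  let φ : ℕ → ℝ := fun n => Nat.rec m (fun _ x => next x) n
  have hmono : StrictMono φ := strictMono_nat_of_lt_succ fun n => (hn (φ n)).1.2
  have hmem : ∀ n, φ n ∈ S := by
    rintro (_ | n)
    · exact hm.1
    · exact (hn (φ n)).1.1
  have hunb : ∀ R, ∃ n, R < φ n := by
    intro R
    refine not_forall_not.1 fun hc => ?_
    exact (infinite_range_of_injective hmono.injective)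
      ((hfin R).subset (range_subset_iff.2 fun n => ⟨hmem n, not_lt.1 (hc n)⟩))
  refine ⟨φ, hmono, ?_, tendsto_atTop_atTop_of_monotone hmono.monotone fun R =>
    (hunb R).imp fun n h => h.le⟩
  refine Subset.antisymm (range_subset_iff.2 hmem) fun x hx => ?_
  by_contra hxr
  -- A missed `x` would stay above every term, because the next element never jumps over a member of
  -- `S`; this contradicts unboundedness.
  have hlt : ∀ n, φ n < x := by
    intro n
    refine lt_of_le_of_ne ?_ fun h => hxr ⟨n, h⟩
    induction n with
    | zero => exact hm.2 hx
    | succ n ih =>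
      exact (hn (φ n)).2 ⟨hx, lt_of_le_of_ne ih fun h => hxr ⟨n, h⟩⟩
  obtain ⟨n, h⟩ := hunb x
  exact (hlt n).not_gt h

/-- The odd extension of a sequence to the integers. -/
def oddExt (ψ : ℕ → ℝ) : ℤ → ℝ
  | Int.ofNat k => ψ k
  | Int.negSucc k => -ψ (k + 1)

theorem oddExt_natCast (ψ : ℕ → ℝ) (k : ℕ) : oddExt ψ k = ψ k := rfl

theorem oddExt_neg {ψ : ℕ → ℝ} (h0 : ψ 0 = 0) (n : ℤ) : oddExt ψ (-n) = -oddExt ψ n := by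
  rcases n with (_ | k) | k
  · change ψ 0 = -ψ 0
    rw [h0, neg_zero]
  · rfl
  · change ψ (k + 1) = -(-ψ (k + 1))
    rw [neg_neg]

theorem strictMono_oddExt {ψ : ℕ → ℝ} (h0 : ψ 0 = 0) (hψ : StrictMono ψ) :
    StrictMono (oddExt ψ) := by
  refine strictMono_int_of_lt_succ fun n => ?_
  rcases n with k | k
  · exact hψ k.lt_succ_self
  · have e : Int.negSucc k + 1 = -(k : ℤ) := by omega
    rw [e, oddExt_neg h0]
    exact neg_lt_neg (hψ k.lt_succ_self)

theorem tendsto_oddExt {ψ : ℕ → ℝ} (h0 : ψ 0 = 0) (hψ : StrictMono ψ)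
    (ht : Tendsto ψ atTop atTop) : Tendsto (oddExt ψ) atTop atTop := by
  refine tendsto_atTop_atTop_of_monotone (strictMono_oddExt h0 hψ).monotone fun b => ?_
  obtain ⟨n, hn⟩ := (ht.eventually_ge_atTop b).exists
  exact ⟨n, hn⟩

end Eigenvalues

end FilmFlow

/-! ### Assembly of the spectrum -/

theorem mainTheorem1 (ε : ℝ) (hε0 : 0 < ε) (hε2 : ε < 2) :
    (FilmFlow.H₀ ε).IsClosable ∧
    {z : ℂ | FilmFlow.IsEigenvalue ((-Complex.I) • FilmFlow.H ε) z}.Infinite ∧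
    ∃ lam : ℤ → ℝ,
      StrictMono lam ∧
      {z : ℂ | FilmFlow.IsEigenvalue ((-Complex.I) • FilmFlow.H ε) z} =
        Set.range (fun n : ℤ => (lam n : ℂ)) ∧
      lam 0 = 0 ∧
      (∀ n : ℤ, lam (-n) = -lam n) ∧
      Filter.Tendsto lam Filter.atTop Filter.atTop := by
  have hα : 0 < 1 / ε := by positivity
  have hreal : ∀ {w : ℂ}, FilmFlow.secular (1 / ε) w = 0 → w = (w.re : ℂ) := fun hw =>
    Complex.ext rfl (by simpa using FilmFlow.im_eq_zero_of_secular_eq_zero hα hw)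
  let S : Set ℝ := {l : ℝ | FilmFlow.secular (1 / ε) l = 0}
  have hSpos : ∀ l ∈ S, 0 < l := fun l hl => by
    simpa using FilmFlow.re_pos_of_secular_eq_zero hα hl
  have hSinf : S.Infinite := fun hfin =>
    FilmFlow.infinite_zeros_secular hα ((hfin.image (fun l : ℝ => (l : ℂ))).subset fun w hw => by
      have hw' : FilmFlow.secular (1 / ε) w = 0 := hw
      refine ⟨w.re, ?_, (hreal hw').symm⟩
      change FilmFlow.secular (1 / ε) _ = 0
      rwa [← hreal hw'])
  have hSfin : ∀ R, (S ∩ Set.Iic R).Finite := fun R => by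
    refine Set.Finite.of_finite_image ((FilmFlow.finite_zeros_secular hα R).subset ?_)
      (Complex.ofReal_injective.injOn)
    rintro _ ⟨l, ⟨hl, hlR⟩, rfl⟩
    refine ⟨hl, ?_⟩
    rw [Complex.norm_real, Real.norm_of_nonneg (hSpos l hl).le]
    exact hlR
  obtain ⟨φ, hφ, hφS, hφt⟩ := FilmFlow.exists_enumeration hSinf hSfin
  have hφmem : ∀ k, φ k ∈ S := fun k => hφS ▸ Set.mem_range_self k
  -- The eigenvalue `0` is put in front of the positive zeros; the odd extension of `ψ` then lists
  -- all eigenvalues.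
  let ψ : ℕ → ℝ := fun n => Nat.casesOn n 0 φ
  have hψ0 : ψ 0 = 0 := rfl
  have hψ : StrictMono ψ := by
    refine strictMono_nat_of_lt_succ ?_
    rintro (_ | k)
    · exact hSpos _ (hφmem 0)
    · exact hφ k.lt_succ_self
  have hψt : Filter.Tendsto ψ Filter.atTop Filter.atTop :=
    (Filter.tendsto_add_atTop_iff_nat 1).1 hφt
  have hset : {z : ℂ | FilmFlow.IsEigenvalue ((-Complex.I) • FilmFlow.H ε) z} =
      Set.range (fun n : ℤ => (FilmFlow.oddExt ψ n : ℂ)) := by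
    have hpos : ∀ {w : ℂ}, FilmFlow.secular (1 / ε) w = 0 →
        ∃ n : ℤ, (FilmFlow.oddExt ψ n : ℂ) = w := fun {w} hw => by
      have hwS : w.re ∈ S := by
        change FilmFlow.secular (1 / ε) _ = 0
        rwa [← hreal hw]
      rw [← hφS] at hwS
      obtain ⟨k, hk⟩ := hwS
      refine ⟨((k + 1 : ℕ) : ℤ), ?_⟩
      rw [FilmFlow.oddExt_natCast, hreal hw, ← hk]
    apply Set.Subset.antisymm
    · intro z hz
      rcases FilmFlow.eigenvalue_cases hε0 hε2 hz with rfl | h | h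
      · exact ⟨0, by change ((ψ 0 : ℝ) : ℂ) = 0; rw [hψ0, Complex.ofReal_zero]⟩
      · exact hpos h
      · obtain ⟨n, hn⟩ := hpos h
        refine ⟨-n, ?_⟩
        change ((FilmFlow.oddExt ψ (-n) : ℝ) : ℂ) = z
        rw [FilmFlow.oddExt_neg hψ0, Complex.ofReal_neg, hn, neg_neg]
    · rintro _ ⟨n, rfl⟩
      have hk : ∀ k, FilmFlow.IsEigenvalue ((-Complex.I) • FilmFlow.H ε) (φ k : ℂ) ∧
          FilmFlow.IsEigenvalue ((-Complex.I) • FilmFlow.H ε) (-(φ k : ℂ)) := fun k =>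
        FilmFlow.isEigenvalue_of_secular hε0 hε2 (hφmem k)
      rcases n with (_ | k) | k
      · change FilmFlow.IsEigenvalue _ ((ψ 0 : ℝ) : ℂ)
        rw [hψ0, Complex.ofReal_zero]
        exact FilmFlow.isEigenvalue_zero ε
      · exact (hk k).1
      · change FilmFlow.IsEigenvalue _ ((-(φ k) : ℝ) : ℂ)
        rw [Complex.ofReal_neg]
        exact (hk k).2
  have hmono := FilmFlow.strictMono_oddExt hψ0 hψ
  refine ⟨FilmFlow.isClosable_H₀ ε, ?_, FilmFlow.oddExt ψ, hmono, hset, hψ0,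
    FilmFlow.oddExt_neg hψ0, FilmFlow.tendsto_oddExt hψ0 hψ hψt⟩
  rw [hset]
  exact Set.infinite_range_of_injective (Complex.ofReal_injective.comp hmono.injective)
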